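/- Let $q$ be a prime power, let $t\ge 2$, and write $\theta_n(q)=\frac{q^{n+1}-1}{q-1}$. Let $Q^+(5,q^t)\subset \mathrm{PG}(5,q^t)$ be the Klein quadric, with equation $X_0X_5+X_1X_4+X_2X_3=0$. A set $\mathcal L$ of planes of $Q^+(5,q^t)$, with characteristic vector $\chi$, is a \emph{Cameron-Liebler set with parameter $x$} if, for every plane $\pi$ of $Q^+(5,q^t)$, exactly $(x-\chi(\pi))q^t$ elements of $\mathcal L$ are disjoint from $\pi$; it is a \emph{degree one Cameron-Liebler set with parameter $x$} if $\chi\in\operatorname{im}(A^T)$, where $A$ is the real point-plane incidence matrix of $Q^+(5,q^t)$, and $|\mathcal L|=2x(q^t+1)$. Under the Klein correspondence (lines of $\mathrm{PG}(3,q^t)$ are mapped to points of $Q^+(5,q^t)$ by Plücker coordinates) a point of $\mathrm{PG}(3,q^t)$ corresponds to the plane of $Q^+(5,q^t)$ formed by the images of the lines through it, and a plane of $\mathrm{PG}(3,q^t)$ to the plane of $Q^+(5,q^t)$ formed by the images of the lines in it. A \emph{scattered $\mathbb F_q$-linear set of rank $k$} in $\mathrm{PG}(3,q^t)$ is a set of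 points $\{\langle u\rangle_{\mathbb F_{q^t}} : 0\ne u\in U\}$, where $U$ is a $k$-dimensional $\mathbb F_q$-subspace of $\mathbb F_{q^t}^4$ with $\dim_{\mathbb F_q}(U\cap P)\le 1$ for every one-dimensional $\mathbb F_{q^t}$-subspace $P$ of $\mathbb F_{q^t}^4$. 1. There exist scattered $\mathbb F_q$-linear sets of rank $2t$ in $\mathrm{PG}(3,q^t)$. 2. Let $P_0$ be any scattered $\mathbb F_q$-linear set of rank $2t$ in $\mathrm{PG}(3,q^t)$, and let $P_2$ be the set of planes of $\mathrm{PG}(3,q^t)$ that contain exactly $\theta_t(q)$ points of $P_0$. Then the set of planes of $Q^+(5,q^t)$ that correspond to the elements of $P_0\cup P_2$ is both a Cameron-Liebler set and a degree one Cameron-Liebler set, with parameter $x=\frac{q^t-1}{q-1}$. 3. Let $t=3$, and embed $\mathrm{PG}(5,q)$ canonically in $\mathrm{PG}(5,q^3)$. There exist lines $\ell$ of $\mathrm{PG}(5,q^3)$ that are skew to $\mathrm{PG}(5,q)$ and satisfy $\langle \ell,\ell^q,\ell^{q^2}\rangle=\mathrm{PG}(5,q^3)$, where $\ell^q,\ell^{q^2}$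 are the conjugates of $\ell$ with respect to $\mathrm{PG}(5,q)$. For every such $\ell$ and every $3$-space $\alpha\cong\mathrm{PG}(3,q^3)$ skew to $\ell$, the projection $P_0$ of $\mathrm{PG}(5,q)$ from $\ell$ onto $\alpha$ is a scattered $\mathbb F_q$-linear set of rank $6$ in $\alpha$. Hence $P_0$ and the set $P_2$ of planes of $\alpha$ that contain exactly $q^3+q^2+q+1$ points of $P_0$ give a Cameron-Liebler set and degree one Cameron-Liebler set of planes of $Q^+(5,q^3)$ with parameter $q^2+q+1$. -/

import Mathlib

namespace KleinCL

/-- The subspaces of projective dimension `d` of the projective space `PG(n, K)`: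
the vector subspaces of `K ^ (n + 1)` of vector dimension `d + 1`. -/
abbrev ProjSub (K : Type*) [Field K] (n d : ℕ) :=
  {W : Submodule K (Fin (n + 1) → K) // Module.finrank K W = d + 1}

/-- `θ_n(q) = (q ^ (n + 1) - 1) / (q - 1) = 1 + q + ⋯ + q ^ n`, the number of points of
`PG(n, q)`. -/
def theta (n q : ℕ) : ℕ := ∑ i ∈ Finset.range (n + 1), q ^ i

/-! ### The Klein quadric -/

/-- The quadratic form `X₀X₅ + X₁X₄ + X₂X₃` whose zeros form the Klein quadric. -/
def kleinForm {K : Type*} [Field K] (x : Fin 6 → K) : K :=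
  x 0 * x 5 + x 1 * x 4 + x 2 * x 3

/-- A subspace of `PG(5, K)` that is contained in the Klein quadric. -/
def IsTotallySingular {K : Type*} [Field K] (W : Submodule K (Fin 6 → K)) : Prop :=
  ∀ x ∈ W, kleinForm x = 0

/-- The points of the Klein quadric. -/
abbrev QuadricPoint (K : Type*) [Field K] :=
  {P : ProjSub K 5 0 // IsTotallySingular P.1}

/-- The generators of the Klein quadric: the planes contained in it. -/
abbrev Generator (K : Type*) [Field K] :=
  {G : ProjSub K 5 2 // IsTotallySingular G.1}

noncomputable instance instFintypeQuadricPoint (K : Type*) [Field K] [Finite K] :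
    Fintype (QuadricPoint K) := Fintype.ofFinite _

/-! ### Cameron-Liebler sets of generators of the Klein quadric (rank `d = 3`, type `e = 0`) -/

open Classical in
/-- The point-generator incidence matrix of the Klein quadric. -/
noncomputable def incidence (K : Type*) [Field K] :
    Matrix (QuadricPoint K) (Generator K) ℝ :=
  Matrix.of fun P G => if P.1.1 ≤ G.1.1 then 1 else 0

/-- The characteristic vector of a set of generators. -/
noncomputable def charVec {K : Type*} [Field K] (L : Set (Generator K)) : Generator K → ℝ :=
  L.indicator fun _ => 1

/-- `L` is a degree one Cameron-Liebler set of planes of the Klein quadric with parameter `x`: its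
characteristic vector lies in the image of the transpose of the incidence matrix, and
`|L| = x ∏_{i = 0}^{d - 2} (|K| ^ (e + i) + 1)`. -/
def IsDegreeOneCameronLiebler {K : Type*} [Field K] [Finite K]
    (L : Set (Generator K)) (x : ℝ) : Prop :=
  charVec L ∈ LinearMap.range (incidence K).transpose.mulVecLin ∧
    (L.ncard : ℝ) = x * ∏ i ∈ Finset.range 2, ((Nat.card K : ℝ) ^ i + 1)

/-- `L` is a Cameron-Liebler set of planes of the Klein quadric with parameter `x` (disjointness
definition): for each generator `π`, exactly `(x - χ(π)) |K| ^ (C(d - 1, 2) + e (d - 1))` elements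
of `L` are disjoint from `π`; the exponent is `C(2, 2) + 0 = 1`. -/
def IsCameronLiebler {K : Type*} [Field K]
    (L : Set (Generator K)) (x : ℝ) : Prop :=
  ∀ π : Generator K,
    ({G ∈ L | Disjoint G.1.1 π.1.1}.ncard : ℝ) =
      (x - charVec L π) * (Nat.card K : ℝ) ^ (Nat.choose 2 2)

/-! ### The Klein correspondence -/

/-- The tuple `(p₀₁, p₀₂, p₀₃, p₁₂, p₃₁, p₂₃)` with `pᵢⱼ = uᵢ vⱼ - uⱼ vᵢ`. -/
def plucker {K : Type*} [Field K] (u v : Fin 4 → K) : Fin 6 → K :=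
  ![u 0 * v 1 - u 1 * v 0, u 0 * v 2 - u 2 * v 0, u 0 * v 3 - u 3 * v 0,
    u 1 * v 2 - u 2 * v 1, u 3 * v 1 - u 1 * v 3, u 2 * v 3 - u 3 * v 2]

/-- The image of a line of `PG(3, K)` under the Klein correspondence: the point of `PG(5, K)`
whose coordinates are the Plücker coordinates of the line. -/
def kleinPoint {K : Type*} [Field K] (l : ProjSub K 3 1) : Submodule K (Fin 6 → K) :=
  Submodule.span K {x | ∃ u ∈ l.1, ∃ v ∈ l.1, x = plucker u v}

/-- `G` is the Latin plane of the point `P`: its points are the images of the lines through `P`. -/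
def IsLatinPlaneOf {K : Type*} [Field K] (G : Generator K) (P : ProjSub K 3 0) : Prop :=
  ∀ X : QuadricPoint K, X.1.1 ≤ G.1.1 ↔ ∃ l : ProjSub K 3 1, P.1 ≤ l.1 ∧ X.1.1 = kleinPoint l

/-- `G` is the Greek plane of the plane `π`: its points are the images of the lines in `π`. -/
def IsGreekPlaneOf {K : Type*} [Field K] (G : Generator K) (π : ProjSub K 3 2) : Prop :=
  ∀ X : QuadricPoint K, X.1.1 ≤ G.1.1 ↔ ∃ l : ProjSub K 3 1, l.1 ≤ π.1 ∧ X.1.1 = kleinPoint l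

/-- The set of generators of the Klein quadric that corresponds to a set `P₀` of points and a set
`P₂` of planes of `PG(3, K)`. -/
def kleinSet {K : Type*} [Field K] (P₀ : Set (ProjSub K 3 0)) (P₂ : Set (ProjSub K 3 2)) :
    Set (Generator K) :=
  {G | (∃ P ∈ P₀, IsLatinPlaneOf G P) ∨ ∃ π ∈ P₂, IsGreekPlaneOf G π}

/-- The planes of `PG(3, K)` that contain exactly `m` points of the set `S`. -/
def planesMeetingIn {K : Type*} [Field K] (S : Set (ProjSub K 3 0)) (m : ℕ) :
    Set (ProjSub K 3 2) :=
  {π | {P ∈ S | P.1 ≤ π.1}.ncard = m}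

/-! ### Linear sets -/

/-- The points `⟨u⟩`, `0 ≠ u ∈ U`, of `PG(n, K)` defined by an `F`-subspace `U` of
`K ^ (n + 1)`. -/
def linearSet (F : Type*) {K : Type*} [Field F] [Field K] [Algebra F K] {n : ℕ}
    (U : Submodule F (Fin (n + 1) → K)) : Set (ProjSub K n 0) :=
  {P | ∃ u ∈ U, u ≠ 0 ∧ P.1 = Submodule.span K {u}}

/-- `S` is a scattered `F`-linear set of rank `k` in `PG(n, K)`: it is defined by an `F`-subspace
`U` of dimension `k` that meets each point of `PG(n, K)` (as an `F`-space) in `F`-dimension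
at most one. -/
def IsScatteredLinearSet (F : Type*) {K : Type*} [Field F] [Field K] [Algebra F K] {n : ℕ}
    (k : ℕ) (S : Set (ProjSub K n 0)) : Prop :=
  ∃ U : Submodule F (Fin (n + 1) → K),
    Module.finrank F U = k ∧
    (∀ P : ProjSub K n 0,
      Module.finrank F (U ⊓ P.1.restrictScalars F : Submodule F (Fin (n + 1) → K)) ≤ 1) ∧
    S = linearSet F U

/-! ### Projected subgeometries -/

/-- The vector of `K ^ 6` with the given coordinates in `F`; the points `⟨embed w⟩`, `w ≠ 0`,
form the subgeometry `PG(5, F)` of `PG(5, K)`. -/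
def embed {F : Type*} (K : Type*) [Field F] [Field K] [Algebra F K] (w : Fin 6 → F) :
    Fin 6 → K :=
  fun i => algebraMap F K (w i)

/-- The conjugate of a subspace of `PG(5, K)` with respect to `PG(5, F)`: its image under
`(x₀, …, x₅) ↦ (x₀ ^ q, …, x₅ ^ q)`, `q = |F|`. -/
def conjugate (F : Type*) {K : Type*} [Field K] (W : Submodule K (Fin 6 → K)) :
    Submodule K (Fin 6 → K) :=
  Submodule.span K ((fun v i => v i ^ Nat.card F) '' (W : Set (Fin 6 → K)))

/-- For `[K : F] = 3`: the line `l` of `PG(5, K)` is skew to `PG(5, F)` and spans `PG(5, K)`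
together with its two conjugate lines. -/
def IsProjectionVertex (F : Type*) {K : Type*} [Field F] [Field K] [Algebra F K]
    (l : ProjSub K 5 1) : Prop :=
  (∀ w : Fin 6 → F, w ≠ 0 → embed K w ∉ l.1) ∧
    l.1 ⊔ conjugate F l.1 ⊔ conjugate F (conjugate F l.1) = ⊤

/-- The projection of the subgeometry `PG(5, F)` from the line `l` onto the solid `α` (the points
`⟨l, x⟩ ∩ α`, for `x` a point of `PG(5, F)`), with `α` coordinatized as `PG(3, K)` by `φ`. -/
def projectedSubgeometry (F : Type*) {K : Type*} [Field F] [Field K] [Algebra F K]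
    (l : ProjSub K 5 1) (α : ProjSub K 5 3) (φ : α.1 ≃ₗ[K] (Fin 4 → K)) :
    Set (ProjSub K 3 0) :=
  {P | ∃ w : Fin 6 → F, w ≠ 0 ∧
    P.1 = (((l.1 ⊔ Submodule.span K {embed K w}) ⊓ α.1).comap α.1.subtype).map
      (φ : α.1 →ₗ[K] (Fin 4 → K))}

end KleinCL

/-! Write `Q = q ^ t` and let the scattered linear set come from the `F`-subspace `U` of `K ^ 4`, of
size `Q ^ 2`. Points and planes of PG(3, Q) are represented by nonzero vectors `p` and covectors
`a`, so each one is counted `Q - 1` times; in exchange all counts become sums over vector spaces.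
Every generator of the Klein quadric is Latin, `latin p`, or Greek, `greek a`. Two Latin planes
coincide or share exactly one point, dually for Greek planes, and `latin p`, `greek a` meet in a
line if `p` lies in the plane `perp a` and are disjoint otherwise.

The crux is that `U` has only two intersection numbers with planes. Let `n(a)` be the number of
vectors of `U` in `perp a`. It is a power of `q`, and at least `Q` because `u ↦ u ⬝ᵥ a` maps `U`
into a space of dimension `t`. Hence `(n(a) - Q) (n(a) - q Q) ≥ 0` for every `a`. Double counting
gives the first two moments of `n`, scatteredness entering in the second, and the sum of these
products over all `a` equals the term at `a = 0`. So every other term vanishes and `n(a)` is `Q` or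
`q Q` (`planeCount_eq_or`); the second value belongs to the planes with `θ_t(q)` points.

It follows that the characteristic function is affine in vector counts on each family: `(m(p) - 1) /
(q - 1)` on Latin planes, with `m(p)` the number of vectors of `U` in `⟨p⟩`, and `(n(a) - Q) / ((q -
1) Q)` on Greek planes (`charVec_latinGen`, `charVec_greekGen`). The disjointness condition then
reduces to double counts of incident vectors. For degree one, weight each quadric point by the
number of nonzero `u ∈ U` whose Latin plane contains it; summing the weights over a generator gives
the characteristic function up to a scalar and a constant, and constants are themselves in the image
of the transposed incidence matrix.

Existence comes from the vectors `(x, x ^ q, y, y ^ q)`. For a projected subgeometry, a violation of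
scatteredness would put `w - c w₀`, with `c` outside `F`, on the vertex; its Frobenius images lie on
the conjugate lines and the three vectors are dependent, whereas the three lines are independent. -/

namespace KleinCL

/-! ### Plücker coordinates and the two families of planes on the Klein quadric. -/

section Algebra

variable {K : Type*} [Field K]

/-- The reversal of coordinates of `K ^ 6`, which interchanges Plücker and dual Plücker
coordinates. -/
def revEquiv (K : Type*) [Field K] : (Fin 6 → K) ≃ₗ[K] (Fin 6 → K) :=
  LinearEquiv.funCongrLeft K K Fin.revPerm

lemma revEquiv_apply (x : Fin 6 → K) : revEquiv K x = ![x 5, x 4, x 3, x 2, x 1, x 0] := by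
  ext i; fin_cases i <;> rfl

lemma revEquiv_revEquiv (x : Fin 6 → K) : revEquiv K (revEquiv K x) = x := by
  ext i; fin_cases i <;> rfl

/-- The contraction of the bivector `x` by the covector `a`. -/
def contr (x : Fin 6 → K) (a : Fin 4 → K) : Fin 4 → K :=
  ![x 0 * a 1 + x 1 * a 2 + x 2 * a 3, -(x 0 * a 0) + x 3 * a 2 - x 4 * a 3,
    -(x 1 * a 0) - x 3 * a 1 + x 5 * a 3, -(x 2 * a 0) + x 4 * a 1 - x 5 * a 2]

/-- The linear map `v ↦ plucker p v`. -/
def pluckerLin (p : Fin 4 → K) : (Fin 4 → K) →ₗ[K] (Fin 6 → K) where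
  toFun := plucker p
  map_add' v w := by ext i; fin_cases i <;> simp [plucker] <;> ring
  map_smul' c v := by ext i; fin_cases i <;> simp [plucker] <;> ring

/-- The linear map `x ↦ contr x a`. -/
def contrLin (a : Fin 4 → K) : (Fin 6 → K) →ₗ[K] (Fin 4 → K) where
  toFun x := contr x a
  map_add' v w := by ext i; fin_cases i <;> simp [contr] <;> ring
  map_smul' c v := by ext i; fin_cases i <;> simp [contr] <;> ring

/-- The plane of the Klein quadric that corresponds to the point `⟨p⟩`. -/
def latin (p : Fin 4 → K) : Submodule K (Fin 6 → K) := LinearMap.range (pluckerLin p)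

/-- The plane of the Klein quadric that corresponds to the plane with equation `u ⬝ᵥ a = 0`. -/
def greek (a : Fin 4 → K) : Submodule K (Fin 6 → K) := LinearMap.ker (contrLin a)

lemma mem_greek {a : Fin 4 → K} {x : Fin 6 → K} : x ∈ greek a ↔ contr x a = 0 := Iff.rfl

lemma mem_latin {p : Fin 4 → K} {x : Fin 6 → K} : x ∈ latin p ↔ ∃ v, plucker p v = x := Iff.rfl

lemma plucker_mem_latin (p v : Fin 4 → K) : plucker p v ∈ latin p := ⟨v, rfl⟩

/-- The right side spans the intersection of the line `⟨u, v⟩` with the plane `perp a`, and is zero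
when the line lies in the plane. This is why `greek a`, the kernel of the contraction, is the plane
of lines in `perp a`. -/
lemma contr_plucker (u v a : Fin 4 → K) :
    contr (plucker u v) a = (v ⬝ᵥ a) • u - (u ⬝ᵥ a) • v := by
  ext i; fin_cases i <;> simp [contr, plucker, dotProduct, Fin.sum_univ_four] <;> ring

lemma contr_rev_plucker_self (p v : Fin 4 → K) : contr (revEquiv K (plucker p v)) p = 0 := by
  ext i; fin_cases i <;> simp [contr, plucker, revEquiv_apply] <;> ring

lemma plucker_add_smul_right (p v w : Fin 4 → K) (c d : K) :
    plucker p (c • v + d • w) = c • plucker p v + d • plucker p w := by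
  ext i; fin_cases i <;> simp [plucker] <;> ring

lemma plucker_self (p : Fin 4 → K) : plucker p p = 0 := by
  ext i; fin_cases i <;> simp [plucker] <;> ring

lemma plucker_smul_right (p v : Fin 4 → K) (c : K) : plucker p (c • v) = c • plucker p v := by
  ext i; fin_cases i <;> simp [plucker] <;> ring

lemma plucker_comm (u v : Fin 4 → K) : plucker u v = -plucker v u := by
  ext i; fin_cases i <;> simp [plucker] <;> ring

lemma plucker_smul_add_smul (u v : Fin 4 → K) (a b c d : K) :
    plucker (a • u + b • v) (c • u + d • v) = (a * d - b * c) • plucker u v := by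
  ext i; fin_cases i <;> simp [plucker] <;> ring

lemma kleinForm_plucker (u v : Fin 4 → K) : kleinForm (plucker u v) = 0 := by
  simp [kleinForm, plucker]; ring

lemma kleinForm_rev (x : Fin 6 → K) : kleinForm (revEquiv K x) = kleinForm x := by
  simp [kleinForm, revEquiv_apply]; ring

lemma exists_ne_of_ne_zero {n : ℕ} {p : Fin n → K} (hp : p ≠ 0) : ∃ i, p i ≠ 0 := by
  by_contra! h
  exact hp (funext h)

lemma mem_latin_iff {p : Fin 4 → K} (hp : p ≠ 0) {x : Fin 6 → K} :
    x ∈ latin p ↔ contr (revEquiv K x) p = 0 := by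
  constructor
  · rintro ⟨v, rfl⟩
    exact contr_rev_plucker_self p v
  · intro h
    have h0 := congrFun h 0
    have h1 := congrFun h 1
    have h2 := congrFun h 2
    have h3 := congrFun h 3
    simp [contr, revEquiv_apply] at h0 h1 h2 h3
    obtain ⟨i, hi⟩ := exists_ne_of_ne_zero hp
    rw [mem_latin]
    fin_cases i
    -- Only `v` modulo `p` matters, so `v` may be chosen with `v i = 0` where `p i ≠ 0`; the Plücker
    -- coordinates involving the index `i` then determine its other entries.
    · refine ⟨![0, x 0 / p 0, x 1 / p 0, x 2 / p 0], ?_⟩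
      simp at hi
      ext i; fin_cases i <;> simp [plucker] <;> field_simp
      · linear_combination h3
      · linear_combination h2
      · linear_combination h1
    · refine ⟨![-x 0 / p 1, 0, x 3 / p 1, -x 4 / p 1], ?_⟩
      simp at hi
      ext i; fin_cases i <;> simp [plucker] <;> field_simp
      · linear_combination -h3
      · linear_combination h2
      · linear_combination -h0
    · refine ⟨![-x 1 / p 2, -x 3 / p 2, 0, x 5 / p 2], ?_⟩
      simp at hi
      ext i; fin_cases i <;> simp [plucker] <;> field_simp
      · linear_combination h3
      · linear_combination -h1
      · linear_combination -h0
    · refine ⟨![-x 2 / p 3, x 4 / p 3, -x 5 / p 3, 0], ?_⟩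
      simp at hi
      ext i; fin_cases i <;> simp [plucker] <;> field_simp
      · linear_combination -h2
      · linear_combination h1
      · linear_combination -h0

lemma rev_mem_latin {a : Fin 4 → K} (ha : a ≠ 0) {x : Fin 6 → K} :
    revEquiv K x ∈ latin a ↔ x ∈ greek a := by
  rw [mem_latin_iff ha, revEquiv_revEquiv, mem_greek]

lemma mem_span_of_plucker_eq_zero {u v : Fin 4 → K} (hu : u ≠ 0) (h : plucker u v = 0) :
    v ∈ Submodule.span K {u} := by
  rw [Submodule.mem_span_singleton]
  have h0 := congrFun h 0
  have h1 := congrFun h 1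
  have h2 := congrFun h 2
  have h3 := congrFun h 3
  have h4 := congrFun h 4
  have h5 := congrFun h 5
  simp [plucker] at h0 h1 h2 h3 h4 h5
  obtain ⟨i, hi⟩ := exists_ne_of_ne_zero hu
  refine ⟨v i / u i, ?_⟩
  fin_cases i <;> simp at hi <;> ext j <;> fin_cases j <;> simp <;> field_simp <;> grind

lemma finrank_latin {p : Fin 4 → K} (hp : p ≠ 0) : Module.finrank K (latin p) = 3 := by
  have h := LinearMap.finrank_range_add_finrank_ker (V := Fin 4 → K) (K := K)
    (pluckerLin p)
  have hk : LinearMap.ker (pluckerLin p) = Submodule.span K {p} := by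
    apply le_antisymm
    · intro v hv
      exact mem_span_of_plucker_eq_zero hp hv
    · rw [Submodule.span_singleton_le_iff_mem]
      exact plucker_self p
  rw [hk, finrank_span_singleton hp, Module.finrank_fin_fun] at h
  change Module.finrank K (latin p) + 1 = 4 at h
  omega

lemma finrank_greek {a : Fin 4 → K} (ha : a ≠ 0) : Module.finrank K (greek a) = 3 := by
  have : greek a = (latin a).comap (revEquiv K : (Fin 6 → K) →ₗ[K] (Fin 6 → K)) := by
    ext x; exact (rev_mem_latin ha).symm
  rw [this, Submodule.comap_equiv_eq_map_symm, LinearEquiv.finrank_map_eq, finrank_latin ha]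

lemma isTotallySingular_latin (p : Fin 4 → K) : IsTotallySingular (latin p) := by
  rintro _ ⟨v, rfl⟩
  exact kleinForm_plucker p v

lemma isTotallySingular_greek {a : Fin 4 → K} (ha : a ≠ 0) : IsTotallySingular (greek a) := by
  intro x hx
  rw [← kleinForm_rev]
  exact isTotallySingular_latin a _ ((rev_mem_latin ha).2 hx)

lemma exists_dotProduct_eq {n : ℕ} (f : (Fin n → K) →ₗ[K] K) : ∃ a : Fin n → K,
    ∀ v, f v = v ⬝ᵥ a := by
  refine ⟨fun i => f (Pi.single i 1), fun v => ?_⟩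
  conv_lhs => rw [← Finset.univ_sum_single v, map_sum]
  refine Finset.sum_congr rfl fun i _ => ?_
  rw [← smul_eq_mul, ← map_smul, ← Pi.single_smul, smul_eq_mul, mul_one]

lemma exists_dotProduct_of_notMem {n : ℕ} {W : Submodule K (Fin n → K)} {p : Fin n → K}
    (hp : p ∉ W) : ∃ a : Fin n → K, p ⬝ᵥ a = 1 ∧ ∀ u ∈ W, u ⬝ᵥ a = 0 := by
  obtain ⟨f, hf, hW⟩ := Submodule.exists_le_ker_of_notMem hp
  obtain ⟨a, ha⟩ := exists_dotProduct_eq f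
  refine ⟨(f p)⁻¹ • a, ?_, fun u hu => ?_⟩
  · rw [dotProduct_smul, ← ha, smul_eq_mul, inv_mul_cancel₀ hf]
  · rw [dotProduct_smul, ← ha, hW hu, smul_zero]

lemma plucker_ne_zero {u v : Fin 4 → K} (hu : u ≠ 0) (hv : v ∉ Submodule.span K {u}) :
    plucker u v ≠ 0 :=
  fun h => hv (mem_span_of_plucker_eq_zero hu h)

lemma left_ne_zero_of_plucker_ne_zero {u v : Fin 4 → K} (h : plucker u v ≠ 0) : u ≠ 0 := by
  rintro rfl
  exact h (by ext i; fin_cases i <;> simp [plucker])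

lemma notMem_span_of_plucker_ne_zero {u v : Fin 4 → K} (h : plucker u v ≠ 0) :
    v ∉ Submodule.span K {u} := by
  rw [Submodule.mem_span_singleton]
  rintro ⟨c, rfl⟩
  exact h (by rw [plucker_smul_right, plucker_self, smul_zero])

/-- Two distinct points lie on a unique common line. -/
lemma latin_inf_latin {p u : Fin 4 → K} (hp : p ≠ 0) (hpu : u ∉ Submodule.span K {p}) :
    latin p ⊓ latin u = Submodule.span K {plucker p u} := by
  have hu : u ≠ 0 := fun h => hpu (h ▸ zero_mem _)
  have hup : p ∉ Submodule.span K {u} := by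
    apply notMem_span_of_plucker_ne_zero
    rw [plucker_comm]
    exact neg_ne_zero.2 (plucker_ne_zero hp hpu)
  apply le_antisymm
  · rintro x ⟨⟨v, rfl⟩, ⟨w, hw⟩⟩
    change plucker u w = plucker p v at hw
    change plucker p v ∈ _
    obtain ⟨a, hpa, ha⟩ := exists_dotProduct_of_notMem hup
    have hua := ha u (Submodule.mem_span_singleton_self u)
    have h := contr_plucker p v a
    rw [← hw, contr_plucker, hpa, hua, one_smul, zero_smul, sub_zero] at h
    have hv : v = (v ⬝ᵥ a) • p + (-(w ⬝ᵥ a)) • u := by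
      rw [neg_smul, h]; abel
    rw [hv, plucker_add_smul_right, plucker_self, smul_zero, zero_add]
    exact Submodule.smul_mem _ _ (Submodule.mem_span_singleton_self _)
  · rw [Submodule.span_singleton_le_iff_mem]
    refine ⟨plucker_mem_latin p u, ?_⟩
    rw [plucker_comm]
    exact neg_mem (plucker_mem_latin u p)

lemma disjoint_latin_greek {p a : Fin 4 → K} (h : p ⬝ᵥ a ≠ 0) :
    Disjoint (latin p) (greek a) := by
  rw [Submodule.disjoint_def]
  rintro _ ⟨v, rfl⟩ hx
  change plucker p v ∈ greek a at hx
  rw [mem_greek, contr_plucker, sub_eq_zero] at hx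
  change plucker p v = 0
  have hv : v = ((p ⬝ᵥ a)⁻¹ * (v ⬝ᵥ a)) • p := by
    rw [mul_smul, hx, smul_smul, inv_mul_cancel₀ h, one_smul]
  rw [hv, plucker_smul_right, plucker_self, smul_zero]

lemma plucker_mem_greek {u v a : Fin 4 → K} (hu : u ⬝ᵥ a = 0) (hv : v ⬝ᵥ a = 0) :
    plucker u v ∈ greek a := by
  rw [mem_greek, contr_plucker, hu, hv, zero_smul, zero_smul, sub_zero]

lemma dotProduct_eq_zero_of_mem_greek {u v a : Fin 4 → K} (hx : plucker u v ≠ 0)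
    (h : plucker u v ∈ greek a) : u ⬝ᵥ a = 0 ∧ v ⬝ᵥ a = 0 := by
  rw [mem_greek, contr_plucker, sub_eq_zero] at h
  have hu := left_ne_zero_of_plucker_ne_zero hx
  have hv := notMem_span_of_plucker_ne_zero hx
  have h0 : u ⬝ᵥ a = 0 := by
    by_contra h0
    apply hv
    rw [Submodule.mem_span_singleton]
    refine ⟨(u ⬝ᵥ a)⁻¹ * (v ⬝ᵥ a), ?_⟩
    rw [mul_smul, h, smul_smul, inv_mul_cancel₀ h0, one_smul]
  rw [h0, zero_smul, smul_eq_zero] at h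
  exact ⟨h0, h.resolve_right hu⟩

/-- The vectors orthogonal to `a`. -/
def perp (a : Fin 4 → K) : Submodule K (Fin 4 → K) :=
  LinearMap.ker ((LinearMap.flip (dotProductBilin K K)) a : (Fin 4 → K) →ₗ[K] K)

lemma mem_perp {a u : Fin 4 → K} : u ∈ perp a ↔ u ⬝ᵥ a = 0 := Iff.rfl

lemma finrank_perp {a : Fin 4 → K} (ha : a ≠ 0) : Module.finrank K (perp a) = 3 := by
  have h := Module.Dual.finrank_ker_add_one_of_ne_zero
    (f := ((LinearMap.flip (dotProductBilin K K)) a : (Fin 4 → K) →ₗ[K] K)) (by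
      intro h
      apply ha
      ext i
      simpa using LinearMap.congr_fun h (Pi.single i 1))
  rw [Module.finrank_fin_fun] at h
  change Module.finrank K (perp a) + 1 = 4 at h
  omega

/-- The lines through `p` in `perp a` form a pencil: the image of the 3-dimensional `perp a` under
`v ↦ plucker p v`, whose kernel is `⟨p⟩`. -/
lemma finrank_latin_inf_greek {p a : Fin 4 → K} (hp : p ≠ 0) (ha : a ≠ 0) (h : p ⬝ᵥ a = 0) :
    Module.finrank K (latin p ⊓ greek a : Submodule K (Fin 6 → K)) = 2 := by
  let f : perp a →ₗ[K] (Fin 6 → K) := pluckerLin p ∘ₗ (perp a).subtype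
  have hr : LinearMap.range f = latin p ⊓ greek a := by
    ext x
    constructor
    · rintro ⟨v, rfl⟩
      exact ⟨⟨v.1, rfl⟩, plucker_mem_greek h v.2⟩
    · rintro ⟨⟨v, rfl⟩, hx⟩
      change plucker p v ∈ greek a at hx
      rw [mem_greek, contr_plucker, h, zero_smul, sub_zero, smul_eq_zero] at hx
      exact ⟨⟨v, hx.resolve_right hp⟩, rfl⟩
  have hk : LinearMap.ker f = Submodule.span K {⟨p, h⟩} := by
    ext v
    rw [LinearMap.mem_ker, Submodule.mem_span_singleton]
    constructor
    · intro hv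
      obtain ⟨c, hc⟩ := Submodule.mem_span_singleton.1 (mem_span_of_plucker_eq_zero hp hv)
      exact ⟨c, Subtype.ext hc⟩
    · rintro ⟨c, rfl⟩
      change plucker p (c • p) = 0
      rw [plucker_smul_right, plucker_self, smul_zero]
  have := LinearMap.finrank_range_add_finrank_ker f
  rw [hr, hk, finrank_span_singleton (by simpa [Subtype.ext_iff] using hp), finrank_perp ha] at this
  omega

/-- A nonzero coordinate `pᵢⱼ` allows a basis of the line normalized in the positions `i`, `j`. The
other entries are read off from `x`, and the quadric equation accounts for the one coordinate
complementary to `pᵢⱼ`. -/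
lemma exists_plucker_eq {x : Fin 6 → K} (hx : x ≠ 0) (h : kleinForm x = 0) :
    ∃ u v, plucker u v = x := by
  unfold kleinForm at h
  obtain ⟨i, hi⟩ := exists_ne_of_ne_zero hx
  fin_cases i <;> simp at hi
  · refine ⟨![1, 0, -x 3 / x 0, x 4 / x 0], ![0, x 0, x 1, x 2], ?_⟩
    ext i; fin_cases i <;> simp [plucker]
    all_goals field_simp
    all_goals grind
  · refine ⟨![1, x 3 / x 1, 0, -x 5 / x 1], ![0, x 0, x 1, x 2], ?_⟩
    ext i; fin_cases i <;> simp [plucker]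
    all_goals field_simp
    all_goals grind
  · refine ⟨![1, -x 4 / x 2, x 5 / x 2, 0], ![0, x 0, x 1, x 2], ?_⟩
    ext i; fin_cases i <;> simp [plucker]
    all_goals field_simp
    all_goals grind
  · refine ⟨![x 0 / x 3, 0, -1, x 4 / x 3], ![x 1, x 3, 0, -x 5], ?_⟩
    ext i; fin_cases i <;> simp [plucker]
    all_goals field_simp
    all_goals grind
  · refine ⟨![-x 0 / x 4, 0, x 3 / x 4, -1], ![x 2, -x 4, x 5, 0], ?_⟩
    ext i; fin_cases i <;> simp [plucker]
    all_goals field_simp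
    all_goals grind
  · refine ⟨![x 1 / x 5, x 3 / x 5, 0, -1], ![x 2, -x 4, x 5, 0], ?_⟩
    ext i; fin_cases i <;> simp [plucker]
    all_goals field_simp
    all_goals grind

end Algebra

/-! ### Classification of the generators and the Klein correspondence. -/

section Klein

variable {K : Type*} [Field K]

lemma mem_latin_of_mem_span_pair {p u v : Fin 4 → K} (hp : p ≠ 0)
    (h : p ∈ Submodule.span K {u, v}) : plucker u v ∈ latin p := by
  obtain ⟨a, b, rfl⟩ := Submodule.mem_span_pair.1 h
  rw [mem_latin_iff hp]
  ext i; fin_cases i <;> simp [contr, plucker, revEquiv_apply] <;> ring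

/-- On decomposable vectors the polar form of the Klein quadric is the 4 × 4 determinant, so
orthogonal points of the quadric are concurrent lines. -/
lemma det_eq_kleinForm_add (u v w z : Fin 4 → K) :
    (Matrix.of ![u, v, w, z]).det = kleinForm (plucker u v + plucker w z) := by
  rw [Matrix.det_succ_row_zero]
  simp [Fin.sum_univ_four, Matrix.det_fin_three, kleinForm, plucker, Fin.succAbove]
  ring

lemma eq_zero_of_plucker_ne_zero {u v : Fin 4 → K} (h : plucker u v ≠ 0) {a b : K}
    (hab : a • u + b • v = 0) : a = 0 ∧ b = 0 := by
  have hu := left_ne_zero_of_plucker_ne_zero h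
  have h1 : b • plucker u v = 0 := by
    have := plucker_add_smul_right u u v a b
    rw [hab, plucker_self, smul_zero, zero_add] at this
    rw [← this]
    ext i; fin_cases i <;> simp [plucker]
  have hb : b = 0 := (smul_eq_zero.1 h1).resolve_right h
  rw [hb, zero_smul, add_zero] at hab
  exact ⟨(smul_eq_zero.1 hab).resolve_right hu, hb⟩

lemma exists_mem_latin_of_kleinForm_add {x y : Fin 6 → K} (hx0 : x ≠ 0) (hy0 : y ≠ 0)
    (hx : kleinForm x = 0) (hy : kleinForm y = 0) (hxy : kleinForm (x + y) = 0) :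
    ∃ p ≠ 0, x ∈ latin p ∧ y ∈ latin p := by
  obtain ⟨u, v, rfl⟩ := exists_plucker_eq hx0 hx
  obtain ⟨w, z, rfl⟩ := exists_plucker_eq hy0 hy
  rw [← det_eq_kleinForm_add] at hxy
  obtain ⟨c, hc, h⟩ := Matrix.exists_vecMul_eq_zero_iff.2 hxy
  have h' : (c 0 • u + c 1 • v) + (c 2 • w + c 3 • z) = 0 := by
    rw [← h]
    ext i
    simp [Matrix.vecMul, dotProduct, Fin.sum_univ_four]
    ring
  have hp : c 0 • u + c 1 • v ≠ 0 := by
    intro h0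
    rw [h0, zero_add] at h'
    obtain ⟨h0, h1⟩ := eq_zero_of_plucker_ne_zero hx0 h0
    obtain ⟨h2, h3⟩ := eq_zero_of_plucker_ne_zero hy0 h'
    apply hc
    ext i; fin_cases i <;> simpa
  refine ⟨_, hp, mem_latin_of_mem_span_pair hp (Submodule.mem_span_pair.2 ⟨_, _, rfl⟩),
    mem_latin_of_mem_span_pair hp (Submodule.mem_span_pair.2 ⟨-c 2, -c 3, ?_⟩)⟩
  rw [neg_smul, neg_smul, ← neg_add, neg_eq_iff_add_eq_zero, add_comm, h']

/-- For singular `z`, the covector `contr (revEquiv K z) p` is the plane joining `p` to the line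
`z`. This identity puts `z` in its Greek plane; the next one does so for a line through `p`
orthogonal to `z`. -/
lemma contr_contr_rev (z : Fin 6 → K) (p : Fin 4 → K) :
    contr z (contr (revEquiv K z) p) = -kleinForm z • p := by
  ext i; fin_cases i <;> simp [contr, revEquiv_apply, kleinForm] <;> ring

lemma contr_plucker_contr_rev (z : Fin 6 → K) (p v : Fin 4 → K) :
    contr (plucker p v) (contr (revEquiv K z) p) =
      (kleinForm z - kleinForm (plucker p v + z)) • p := by
  ext i; fin_cases i <;> simp [contr, revEquiv_apply, kleinForm, plucker] <;> ring

lemma eq_of_le_of_finrank_three {W W' : Submodule K (Fin 6 → K)} (h : W ≤ W')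
    (hW : Module.finrank K W = 3) (hW' : Module.finrank K W' = 3) : W = W' :=
  Submodule.eq_of_le_of_finrank_eq h (hW.trans hW'.symm)

/-- Every plane of the Klein quadric is Latin or Greek. -/
lemma eq_latin_or_eq_greek {G : Submodule K (Fin 6 → K)} (hG : IsTotallySingular G)
    (h3 : Module.finrank K G = 3) : (∃ p ≠ 0, G = latin p) ∨ ∃ a ≠ 0, G = greek a := by
  have hlt : ∀ W : Submodule K (Fin 6 → K), Module.finrank K W < 3 → ∃ x ∈ G, x ∉ W := by
    intro W hW
    by_contra! h
    have := Submodule.finrank_mono (s := G) (t := W) h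
    omega
  obtain ⟨x, hx, hx0⟩ := hlt ⊥ (by simp)
  rw [Submodule.mem_bot] at hx0
  obtain ⟨y, hy, hxy⟩ := hlt (Submodule.span K {x}) (by rw [finrank_span_singleton hx0]; norm_num)
  have hy0 : y ≠ 0 := fun h => hxy (h ▸ zero_mem _)
  obtain ⟨p, hp, hxp, hyp⟩ := exists_mem_latin_of_kleinForm_add hx0 hy0 (hG x hx) (hG y hy)
    (hG _ (add_mem hx hy))
  by_cases hGp : G ≤ latin p
  · exact Or.inl ⟨p, hp, eq_of_le_of_finrank_three hGp h3 (finrank_latin hp)⟩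
  · right
    obtain ⟨z, hz, hzp⟩ := Set.not_subset.1 hGp
    have hb : contr (revEquiv K z) p ≠ 0 := fun h => hzp ((mem_latin_iff hp).2 h)
    set b := contr (revEquiv K z) p with hbdef
    have hlg : ∀ x ∈ G, x ∈ latin p → x ∈ greek b := by
      rintro _ hx ⟨v, rfl⟩
      change plucker p v ∈ G at hx
      change contr (plucker p v) b = 0
      rw [hbdef, contr_plucker_contr_rev, hG z hz, hG _ (add_mem hx hz), sub_zero, zero_smul]
    have hzg : z ∈ greek b := by
      rw [mem_greek, hbdef, contr_contr_rev, hG z hz, neg_zero, zero_smul]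
    -- The strict chain `⟨x⟩ < G ⊓ latin p < G ⊓ greek b` forces dimension 3 at its top, so `G` is
    -- contained in `greek b`.
    have h1 : Submodule.span K {x} < G ⊓ latin p := by
      refine lt_of_le_of_ne ?_ fun h => hxy (h ▸ ⟨hy, hyp⟩)
      rw [Submodule.span_singleton_le_iff_mem]
      exact ⟨hx, hxp⟩
    have h2 : G ⊓ latin p < G ⊓ greek b := by
      refine lt_of_le_of_ne (fun w hw => ⟨hw.1, hlg w hw.1 hw.2⟩) fun h => hzp ?_
      have : z ∈ G ⊓ latin p := h ▸ ⟨hz, hzg⟩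
      exact this.2
    have h1 := Submodule.finrank_lt_finrank_of_lt h1
    have h2 := Submodule.finrank_lt_finrank_of_lt h2
    rw [finrank_span_singleton hx0] at h1
    have h4 := Submodule.finrank_mono (inf_le_left : G ⊓ greek b ≤ G)
    have h5 : G ⊓ greek b = G := Submodule.eq_of_le_of_finrank_eq inf_le_left (by omega)
    exact ⟨b, hb, eq_of_le_of_finrank_three (inf_eq_left.1 h5) h3 (finrank_greek hb)⟩

lemma kleinForm_smul (c : K) (x : Fin 6 → K) : kleinForm (c • x) = c ^ 2 * kleinForm x := by
  simp [kleinForm]; ring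

/-- The point of the Klein quadric spanned by a singular vector. -/
def mkQuadricPoint (x : Fin 6 → K) (hx : x ≠ 0) (h : kleinForm x = 0) : QuadricPoint K :=
  ⟨⟨Submodule.span K {x}, finrank_span_singleton hx⟩, fun y hy => by
    obtain ⟨c, rfl⟩ := Submodule.mem_span_singleton.1 hy
    rw [kleinForm_smul, h, mul_zero]⟩

lemma exists_eq_span_singleton {n : ℕ} (P : ProjSub K n 0) :
    ∃ p, p ≠ 0 ∧ P.1 = Submodule.span K {p} := by
  obtain ⟨v, hv, h⟩ := finrank_eq_one_iff'.1 P.2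
  refine ⟨v.1, by simpa using hv, le_antisymm (fun w hw => ?_) ?_⟩
  · obtain ⟨c, hc⟩ := h ⟨w, hw⟩
    exact Submodule.mem_span_singleton.2 ⟨c, congrArg Subtype.val hc⟩
  · rw [Submodule.span_singleton_le_iff_mem]
    exact v.2

lemma eq_of_quadricPoint_le_iff {W W' : Submodule K (Fin 6 → K)} (hW : IsTotallySingular W)
    (hW' : IsTotallySingular W') (h : ∀ X : QuadricPoint K, X.1.1 ≤ W ↔ X.1.1 ≤ W') :
    W = W' := by
  have key : ∀ x, x ≠ 0 → kleinForm x = 0 → (x ∈ W ↔ x ∈ W') := by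
    intro x hx hs
    simpa [mkQuadricPoint, Submodule.span_singleton_le_iff_mem] using h (mkQuadricPoint x hx hs)
  ext x
  by_cases hx : x = 0
  · simp [hx]
  · exact ⟨fun h => (key x hx (hW x h)).1 h, fun h => (key x hx (hW' x h)).2 h⟩

lemma finrank_span_pair_eq_two {n : ℕ} {u v : Fin n → K} (hu : u ≠ 0)
    (hv : v ∉ Submodule.span K {u}) :
    Module.finrank K (Submodule.span K {u, v}) = 2 := by
  have h : LinearIndependent K ![u, v] := by
    rw [LinearIndependent.pair_iff' hu]
    exact fun a ha => hv (Submodule.mem_span_singleton.2 ⟨a, ha⟩)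
  have hr : Set.range ![u, v] = {u, v} := by
    ext x
    simp [eq_comm, or_comm]
  rw [← hr, finrank_span_eq_card h, Fintype.card_fin]

lemma exists_eq_span_pair {n : ℕ} {l : Submodule K (Fin n → K)}
    (hl : Module.finrank K l = 2) {p : Fin n → K} (hp : p ≠ 0) (hpl : p ∈ l) :
    ∃ v, v ∉ Submodule.span K {p} ∧ l = Submodule.span K {p, v} := by
  have : ∃ v ∈ l, v ∉ Submodule.span K {p} := by
    by_contra! h
    have := Submodule.finrank_mono (s := l) (t := Submodule.span K {p}) h
    rw [finrank_span_singleton hp] at this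
    omega
  obtain ⟨v, hv, hvp⟩ := this
  refine ⟨v, hvp, (Submodule.eq_of_le_of_finrank_eq ?_ ?_).symm⟩
  · rw [Submodule.span_le]
    rintro _ (rfl | rfl) <;> assumption
  · rw [finrank_span_pair_eq_two hp hvp, hl]

lemma kleinPoint_eq_span {l : ProjSub K 3 1} {u v : Fin 4 → K}
    (hl : l.1 = Submodule.span K {u, v}) : kleinPoint l = Submodule.span K {plucker u v} := by
  unfold kleinPoint
  rw [hl]
  apply le_antisymm
  · rw [Submodule.span_le]
    rintro _ ⟨w, hw, z, hz, rfl⟩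
    obtain ⟨a, b, rfl⟩ := Submodule.mem_span_pair.1 hw
    obtain ⟨c, d, rfl⟩ := Submodule.mem_span_pair.1 hz
    rw [plucker_smul_add_smul]
    exact Submodule.smul_mem _ _ (Submodule.mem_span_singleton_self _)
  · rw [Submodule.span_singleton_le_iff_mem]
    exact Submodule.subset_span ⟨u, Submodule.subset_span (by simp), v,
      Submodule.subset_span (by simp), rfl⟩

/-- The line spanned by `u` and `v`. -/
def mkLine (u v : Fin 4 → K) (h : plucker u v ≠ 0) : ProjSub K 3 1 :=
  ⟨Submodule.span K {u, v}, finrank_span_pair_eq_two (left_ne_zero_of_plucker_ne_zero h)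
    (notMem_span_of_plucker_ne_zero h)⟩

lemma le_latin_iff {P : ProjSub K 3 0} {p : Fin 4 → K} (hp : p ≠ 0)
    (hP : P.1 = Submodule.span K {p}) (X : QuadricPoint K) :
    X.1.1 ≤ latin p ↔ ∃ l : ProjSub K 3 1, P.1 ≤ l.1 ∧ X.1.1 = kleinPoint l := by
  rw [hP]
  constructor
  · intro h
    obtain ⟨x, hx, hX⟩ := exists_eq_span_singleton X.1
    rw [hX, Submodule.span_singleton_le_iff_mem] at h
    obtain ⟨v, rfl⟩ := h
    refine ⟨mkLine p v hx, ?_, ?_⟩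
    · rw [Submodule.span_singleton_le_iff_mem]
      exact Submodule.subset_span (by simp)
    · rw [hX, kleinPoint_eq_span (l := mkLine p v hx) rfl]
      rfl
  · rintro ⟨l, hl, hX⟩
    rw [Submodule.span_singleton_le_iff_mem] at hl
    obtain ⟨v, -, hv⟩ := exists_eq_span_pair l.2 hp hl
    rw [hX, kleinPoint_eq_span hv, Submodule.span_singleton_le_iff_mem]
    exact plucker_mem_latin p v

lemma le_greek_iff {π : ProjSub K 3 2} {a : Fin 4 → K} (hπ : π.1 = perp a)
    (X : QuadricPoint K) :
    X.1.1 ≤ greek a ↔ ∃ l : ProjSub K 3 1, l.1 ≤ π.1 ∧ X.1.1 = kleinPoint l := by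
  rw [hπ]
  constructor
  · intro h
    obtain ⟨x, hx, hX⟩ := exists_eq_span_singleton X.1
    obtain ⟨u, v, rfl⟩ := exists_plucker_eq hx
      (X.2 x (hX ▸ Submodule.mem_span_singleton_self x))
    rw [hX, Submodule.span_singleton_le_iff_mem] at h
    obtain ⟨hu, hv⟩ := dotProduct_eq_zero_of_mem_greek hx h
    refine ⟨mkLine u v hx, ?_, ?_⟩
    · change Submodule.span K {u, v} ≤ _
      rw [Submodule.span_le]
      rintro _ (rfl | rfl)
      exacts [hu, hv]
    · rw [hX, kleinPoint_eq_span (l := mkLine u v hx) rfl]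
  · rintro ⟨l, hl, hX⟩
    have hl0 : ∃ p ∈ l.1, p ≠ 0 := by
      by_contra! h
      have h0 : l.1 = ⊥ := (Submodule.eq_bot_iff _).2 h
      have := l.2
      rw [h0, finrank_bot] at this
      omega
    obtain ⟨p, hpl, hp⟩ := hl0
    obtain ⟨v, -, hv⟩ := exists_eq_span_pair l.2 hp hpl
    rw [hX, kleinPoint_eq_span hv, Submodule.span_singleton_le_iff_mem]
    exact plucker_mem_greek (hl hpl) (hl (hv ▸ Submodule.subset_span (by simp)))

lemma isLatinPlaneOf_iff {P : ProjSub K 3 0} {p : Fin 4 → K} (hp : p ≠ 0)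
    (hP : P.1 = Submodule.span K {p}) (G : Generator K) :
    IsLatinPlaneOf G P ↔ G.1.1 = latin p := by
  unfold IsLatinPlaneOf
  simp_rw [← le_latin_iff hp hP]
  exact ⟨eq_of_quadricPoint_le_iff G.2 (isTotallySingular_latin p), fun h X => by rw [h]⟩

lemma isGreekPlaneOf_iff {π : ProjSub K 3 2} {a : Fin 4 → K} (ha : a ≠ 0)
    (hπ : π.1 = perp a) (G : Generator K) :
    IsGreekPlaneOf G π ↔ G.1.1 = greek a := by
  unfold IsGreekPlaneOf
  simp_rw [← le_greek_iff hπ]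
  exact ⟨eq_of_quadricPoint_le_iff G.2 (isTotallySingular_greek ha), fun h X => by rw [h]⟩

lemma exists_eq_perp (π : ProjSub K 3 2) : ∃ a, a ≠ 0 ∧ π.1 = perp a := by
  have hlt : π.1 < ⊤ := by
    rw [lt_top_iff_ne_top]
    intro h
    have := π.2
    rw [h, finrank_top, Module.finrank_fin_fun] at this
    omega
  obtain ⟨p, -, hp⟩ := SetLike.exists_of_lt hlt
  obtain ⟨a, hpa, ha⟩ := exists_dotProduct_of_notMem hp
  have ha0 : a ≠ 0 := by
    rintro rfl
    simp at hpa
  exact ⟨a, ha0, Submodule.eq_of_le_of_finrank_eq ha (π.2.trans (finrank_perp ha0).symm)⟩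

lemma mem_perp_comm {a u : Fin 4 → K} : u ∈ perp a ↔ a ∈ perp u := by
  rw [mem_perp, mem_perp, dotProduct_comm]

lemma mem_span_singleton_comm {n : ℕ} {u p : Fin n → K} (hu : u ≠ 0) :
    u ∈ Submodule.span K {p} ↔ p ≠ 0 ∧ p ∈ Submodule.span K {u} := by
  rw [Submodule.mem_span_singleton, Submodule.mem_span_singleton]
  constructor
  · rintro ⟨c, rfl⟩
    rw [smul_ne_zero_iff] at hu
    exact ⟨hu.2, c⁻¹, by rw [smul_smul, inv_mul_cancel₀ hu.1, one_smul]⟩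
  · rintro ⟨hp, c, rfl⟩
    rw [smul_ne_zero_iff] at hp
    exact ⟨c⁻¹, by rw [smul_smul, inv_mul_cancel₀ hp.1, one_smul]⟩

lemma finrank_perp_inf_perp {p u : Fin 4 → K} (hp : p ≠ 0) (hu : u ∉ Submodule.span K {p}) :
    Module.finrank K (perp p ⊓ perp u : Submodule K (Fin 4 → K)) = 2 := by
  have hu0 : u ≠ 0 := fun h => hu (h ▸ zero_mem _)
  have h1 := Submodule.finrank_sup_add_finrank_inf_eq (perp p) (perp u)
  rw [finrank_perp hp, finrank_perp hu0] at h1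
  have h2 := Submodule.finrank_le (perp p ⊔ perp u)
  rw [Module.finrank_fin_fun] at h2
  have h3 : perp p ⊓ perp u < perp p := by
    refine lt_of_le_of_ne inf_le_left fun h => ?_
    obtain ⟨a, ha, hpa⟩ := exists_dotProduct_of_notMem hu
    have h4 : a ∈ perp p ⊓ perp u := by
      rw [h, mem_perp_comm]
      exact hpa p (Submodule.mem_span_singleton_self p)
    have h5 := mem_perp_comm.1 h4.2
    rw [mem_perp, ha] at h5
    exact one_ne_zero h5
  have h3 := Submodule.finrank_lt_finrank_of_lt h3
  rw [finrank_perp hp] at h3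
  omega

end Klein

/-! ### Intersection numbers of a scattered subspace with points and planes. -/

section Counting

open Finset Classical

variable {K : Type*} [Field K] [Fintype K]

lemma sum_ite_eq_natCard {α : Type*} [Fintype α] (s : Set α) :
    ∑ x, (if x ∈ s then (1 : ℝ) else 0) = Nat.card s := by
  rw [← Finset.sum_filter, Finset.sum_const, Nat.card_eq_fintype_card, Fintype.card_subtype]
  simp

lemma sum_ite_mem_submodule {n : ℕ} (W : Submodule K (Fin n → K)) :
    ∑ x, (if x ∈ W then (1 : ℝ) else 0) = (Nat.card K : ℝ) ^ Module.finrank K W := by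
  have h := sum_ite_eq_natCard (W : Set (Fin n → K))
  have h2 : Nat.card (W : Set (Fin n → K)) = Nat.card K ^ Module.finrank K W :=
    Module.natCard_eq_pow_finrank
  rw [h2] at h
  push_cast at h
  exact h

lemma sum_mem_perp (u : Fin 4 → K) :
    ∑ a, (if u ∈ perp a then (1 : ℝ) else 0) =
      if u = 0 then (Nat.card K : ℝ) ^ 4 else (Nat.card K : ℝ) ^ 3 := by
  simp_rw [mem_perp_comm (u := u)]
  rw [sum_ite_mem_submodule]
  split_ifs with h
  · have : perp u = ⊤ := by
      rw [eq_top_iff]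
      intro x _
      rw [mem_perp, h, dotProduct_zero]
    rw [this, finrank_top, Module.finrank_fin_fun]
  · rw [finrank_perp h]

lemma sum_mem_perp_mul {p : Fin 4 → K} (hp : p ≠ 0) (u : Fin 4 → K) :
    ∑ a, (if p ∈ perp a then (1 : ℝ) else 0) * (if u ∈ perp a then (1 : ℝ) else 0) =
      if u ∈ Submodule.span K {p} then (Nat.card K : ℝ) ^ 3 else (Nat.card K : ℝ) ^ 2 := by
  have : ∀ a, (if p ∈ perp a then (1 : ℝ) else 0) * (if u ∈ perp a then (1 : ℝ) else 0) =
      if a ∈ perp p ⊓ perp u then 1 else 0 := by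
    intro a
    rw [mem_perp_comm, mem_perp_comm (u := u), Submodule.mem_inf]
    split_ifs <;> simp_all
  simp_rw [this]
  rw [sum_ite_mem_submodule]
  split_ifs with h
  · have : perp p ⊓ perp u = perp p := by
      rw [inf_eq_left]
      intro a ha
      obtain ⟨c, rfl⟩ := Submodule.mem_span_singleton.1 h
      rw [mem_perp] at ha ⊢
      rw [dotProduct_smul, ha, smul_zero]
    rw [this, finrank_perp hp]
  · rw [finrank_perp_inf_perp hp h]

lemma sum_ite_mem_span {n : ℕ} {u : Fin n → K} (hu : u ≠ 0) :
    ∑ p, (if p ≠ 0 ∧ p ∈ Submodule.span K {u} then (1 : ℝ) else 0) = Nat.card K - 1 := by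
  have h := sum_ite_mem_submodule (Submodule.span K {u})
  rw [finrank_span_singleton hu, pow_one] at h
  rw [← h, eq_sub_iff_add_eq]
  have h1 : (1 : ℝ) = ∑ p : Fin n → K, if p = 0 then 1 else 0 := by simp
  conv_lhs => rw [h1, ← Finset.sum_add_distrib]
  refine Finset.sum_congr rfl fun p _ => ?_
  by_cases hp : p = 0 <;> simp [hp]

/-! ### Counting with the vectors of a scattered subspace -/

variable {F : Type*} [Field F] [Algebra F K]

/-- The number of vectors of `U` in the plane `perp a`. -/
noncomputable def planeCount (U : Submodule F (Fin 4 → K)) (a : Fin 4 → K) : ℕ :=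
  Nat.card (U ⊓ (perp a).restrictScalars F : Submodule F (Fin 4 → K))

/-- The number of vectors of `U` in the point `⟨p⟩`. -/
noncomputable def pointCount (U : Submodule F (Fin 4 → K)) (p : Fin 4 → K) : ℕ :=
  Nat.card (U ⊓ (Submodule.span K {p}).restrictScalars F : Submodule F (Fin 4 → K))

/-- The `F`-subspace `U` meets each point of `PG(3, K)` in dimension at most one. -/
def IsScattered (U : Submodule F (Fin 4 → K)) : Prop :=
  ∀ P : ProjSub K 3 0,
    Module.finrank F (U ⊓ P.1.restrictScalars F : Submodule F (Fin 4 → K)) ≤ 1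

variable {U : Submodule F (Fin 4 → K)}

lemma planeCount_eq_sum (a : Fin 4 → K) :
    (planeCount U a : ℝ) = ∑ u with u ∈ U, if u ∈ perp a then 1 else 0 := by
  rw [Finset.sum_filter]
  have h := sum_ite_eq_natCard
    ((U ⊓ (perp a).restrictScalars F : Submodule F (Fin 4 → K)) : Set (Fin 4 → K))
  refine Eq.trans h.symm (Finset.sum_congr rfl fun u _ => ?_)
  by_cases h1 : u ∈ U <;> by_cases h2 : u ∈ perp a <;> simp [h1, h2]

lemma pointCount_eq_sum (p : Fin 4 → K) :
    (pointCount U p : ℝ) = ∑ u with u ∈ U, if u ∈ Submodule.span K {p} then 1 else 0 := by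
  rw [Finset.sum_filter]
  have h := sum_ite_eq_natCard
    ((U ⊓ (Submodule.span K {p}).restrictScalars F : Submodule F (Fin 4 → K)) : Set (Fin 4 → K))
  refine Eq.trans h.symm (Finset.sum_congr rfl fun u _ => ?_)
  by_cases h1 : u ∈ U <;> by_cases h2 : u ∈ Submodule.span K {p} <;> simp [h1, h2]

lemma natCard_eq_pow : Nat.card K = Nat.card F ^ Module.finrank F K :=
  Module.natCard_eq_pow_finrank

lemma sum_filter_ite_zero (x y : ℝ) :
    ∑ u with u ∈ U, (if u = 0 then x else y) = x + ((univ.filter (· ∈ U)).card - 1) * y := by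
  have h : ∀ u : Fin 4 → K, (if u = 0 then x else y) = (if u = 0 then x - y else 0) + y := by
    intro u
    split_ifs <;> ring
  simp_rw [h]
  rw [Finset.sum_add_distrib, Finset.sum_ite_eq', if_pos (by simp), Finset.sum_const, nsmul_eq_mul]
  ring

lemma pointCount_eq_pow (p : Fin 4 → K) : pointCount U p = Nat.card F ^ Module.finrank F
    (U ⊓ (Submodule.span K {p}).restrictScalars F : Submodule F (Fin 4 → K)) :=
  Module.natCard_eq_pow_finrank

lemma pointCount_of_mem (hs : IsScattered U) {p u : Fin 4 → K} (hp : p ≠ 0) (hu : u ≠ 0)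
    (huU : u ∈ U) (hup : u ∈ Submodule.span K {p}) : pointCount U p = Nat.card F := by
  have h1 := hs ⟨Submodule.span K {p}, finrank_span_singleton hp⟩
  have h2 : 0 < Module.finrank F
      (U ⊓ (Submodule.span K {p}).restrictScalars F : Submodule F (Fin 4 → K)) := by
    rw [Module.finrank_pos_iff_exists_ne_zero]
    exact ⟨⟨u, huU, hup⟩, by simpa [Subtype.ext_iff] using hu⟩
  rw [pointCount_eq_pow]
  have : Module.finrank F
      (U ⊓ (Submodule.span K {p}).restrictScalars F : Submodule F (Fin 4 → K)) = 1 :=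
    le_antisymm h1 h2
  rw [this, pow_one]

lemma pointCount_of_forall {p : Fin 4 → K}
    (h : ∀ u ∈ U, u ∈ Submodule.span K {p} → u = 0) : pointCount U p = 1 := by
  have : (U ⊓ (Submodule.span K {p}).restrictScalars F : Submodule F (Fin 4 → K)) = ⊥ :=
    (Submodule.eq_bot_iff _).2 fun u hu => h u hu.1 hu.2
  rw [pointCount_eq_pow, this, finrank_bot, pow_zero]

lemma pointCount_sub_one (p : Fin 4 → K) : (pointCount U p : ℝ) - 1 = ∑ u with u ∈ U,
    if u = 0 then 0 else if u ∈ Submodule.span K {p} then 1 else 0 := by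
  rw [pointCount_eq_sum, ← Finset.add_sum_erase _ _ (show 0 ∈ univ.filter (· ∈ U) by simp),
    ← Finset.add_sum_erase (a := 0) _ _ (show 0 ∈ univ.filter (· ∈ U) by simp)]
  rw [if_pos (zero_mem _), if_pos rfl, zero_add, add_sub_cancel_left]
  refine Finset.sum_congr rfl fun u hu => ?_
  rw [if_neg (Finset.ne_of_mem_erase hu)]

lemma card_filter_mem (hU : Module.finrank F U = 2 * Module.finrank F K) :
    ((univ.filter (· ∈ U)).card : ℝ) = (Nat.card K : ℝ) ^ 2 := by
  have h : Nat.card U = Nat.card F ^ Module.finrank F U := Module.natCard_eq_pow_finrank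
  have h2 : Nat.card U = (univ.filter (· ∈ U)).card := by
    rw [Nat.card_eq_fintype_card, Fintype.card_subtype]
  rw [← h2, h, hU, natCard_eq_pow (F := F) (K := K)]
  push_cast
  rw [← pow_mul, mul_comm]

lemma planeCount_zero (hU : Module.finrank F U = 2 * Module.finrank F K) :
    (planeCount U 0 : ℝ) = (Nat.card K : ℝ) ^ 2 := by
  rw [planeCount_eq_sum, ← card_filter_mem hU, Finset.card_eq_sum_ones]
  push_cast
  refine Finset.sum_congr rfl fun u _ => if_pos ?_
  rw [mem_perp, dotProduct_zero]

lemma sum_planeCount (hU : Module.finrank F U = 2 * Module.finrank F K) :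
    ∑ a, (planeCount U a : ℝ) =
      (Nat.card K : ℝ) ^ 4 + ((Nat.card K : ℝ) ^ 2 - 1) * (Nat.card K : ℝ) ^ 3 := by
  simp_rw [planeCount_eq_sum]
  rw [Finset.sum_comm]
  simp_rw [sum_mem_perp]
  rw [sum_filter_ite_zero, card_filter_mem hU]

/-- Double count of pairs `(u, a)` with `u ∈ U` and both `u`, `p` in `perp a`: there are `Q ^ 3`
covectors `a` when `u ∈ ⟨p⟩` and `Q ^ 2` otherwise. -/
lemma sum_planeCount_of_mem (hU : Module.finrank F U = 2 * Module.finrank F K)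
    {p : Fin 4 → K} (hp : p ≠ 0) :
    ∑ a, (if p ∈ perp a then (1 : ℝ) else 0) * planeCount U a =
      pointCount U p * (Nat.card K : ℝ) ^ 3 +
        ((Nat.card K : ℝ) ^ 2 - pointCount U p) * (Nat.card K : ℝ) ^ 2 := by
  simp_rw [planeCount_eq_sum, Finset.mul_sum]
  rw [Finset.sum_comm]
  simp_rw [sum_mem_perp_mul hp]
  rw [pointCount_eq_sum, ← card_filter_mem hU, Finset.card_eq_sum_ones]
  push_cast
  rw [Finset.sum_mul, ← Finset.sum_sub_distrib, Finset.sum_mul, ← Finset.sum_add_distrib]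
  refine Finset.sum_congr rfl fun u _ => ?_
  split_ifs <;> ring

lemma sum_planeCount_sq (hU : Module.finrank F U = 2 * Module.finrank F K)
    (hs : IsScattered U) :
    ∑ a, (planeCount U a : ℝ) ^ 2 =
      (Nat.card K : ℝ) ^ 4 + ((Nat.card K : ℝ) ^ 2 - 1) * (Nat.card K : ℝ) ^ 3 +
        ((Nat.card K : ℝ) ^ 2 - 1) * (Nat.card F * (Nat.card K : ℝ) ^ 3 +
        ((Nat.card K : ℝ) ^ 2 - Nat.card F) * (Nat.card K : ℝ) ^ 2) := by
  have h1 : ∀ a, (planeCount U a : ℝ) ^ 2 =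
      ∑ u with u ∈ U, (if u ∈ perp a then (1 : ℝ) else 0) * planeCount U a := by
    intro a
    rw [← Finset.sum_mul, ← planeCount_eq_sum, sq]
  simp_rw [h1]
  rw [Finset.sum_comm]
  -- Scatteredness enters here: each nonzero `u ∈ U` has exactly `q` vectors of `U` in its point,
  -- zero included.
  have h2 : ∀ u ∈ univ.filter (· ∈ U),
      ∑ a, (if u ∈ perp a then (1 : ℝ) else 0) * planeCount U a =
      if u = 0 then (Nat.card K : ℝ) ^ 4 + ((Nat.card K : ℝ) ^ 2 - 1) * (Nat.card K : ℝ) ^ 3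
      else Nat.card F * (Nat.card K : ℝ) ^ 3 +
        ((Nat.card K : ℝ) ^ 2 - Nat.card F) * (Nat.card K : ℝ) ^ 2 := by
    intro u hu
    split_ifs with h
    · rw [← sum_planeCount hU]
      refine Finset.sum_congr rfl fun a _ => ?_
      rw [if_pos (h ▸ zero_mem _), one_mul]
    · rw [sum_planeCount_of_mem hU h, pointCount_of_mem hs h h (by simpa using hu)
        (Submodule.mem_span_singleton_self u)]
  rw [Finset.sum_congr rfl h2, sum_filter_ite_zero, card_filter_mem hU]

/-- The functional `u ↦ u ⬝ᵥ a` sends `U`, of dimension `2t`, into `K`, of dimension `t`, so its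
kernel on `U` has dimension at least `t`. -/
lemma exists_planeCount_eq_pow (hU : Module.finrank F U = 2 * Module.finrank F K)
    (a : Fin 4 → K) : ∃ d, Module.finrank F K ≤ d ∧ planeCount U a = Nat.card F ^ d := by
  refine ⟨_, ?_, (Module.natCard_eq_pow_finrank :
    planeCount U a = Nat.card F ^ Module.finrank F
      (U ⊓ (perp a).restrictScalars F : Submodule F (Fin 4 → K)))⟩
  let f : (Fin 4 → K) →ₗ[K] K := (LinearMap.flip (dotProductBilin K K)) a
  let g : U →ₗ[F] K := (f.restrictScalars F) ∘ₗ U.subtype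
  have h := LinearMap.finrank_range_add_finrank_ker g
  have h1 := Submodule.finrank_le (LinearMap.range g)
  have h2 : Module.finrank F (LinearMap.ker g) ≤ Module.finrank F
      (U ⊓ (perp a).restrictScalars F : Submodule F (Fin 4 → K)) := by
    have : (LinearMap.ker g).map U.subtype ≤ U ⊓ (perp a).restrictScalars F := by
      rintro _ ⟨u, hu, rfl⟩
      exact ⟨u.2, hu⟩
    exact (LinearEquiv.finrank_eq
      (Submodule.equivMapOfInjective _ U.injective_subtype (LinearMap.ker g))).trans_le
      (Submodule.finrank_mono this)
  omega

/-- Each nonzero `u ∈ U` is counted once for each of the `Q - 1` nonzero vectors `p` spanning `⟨u⟩`.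
-/
lemma sum_pointCount (hU : Module.finrank F U = 2 * Module.finrank F K) :
    ∑ p with p ≠ 0, ((pointCount U p : ℝ) - 1) =
      ((Nat.card K : ℝ) ^ 2 - 1) * (Nat.card K - 1) := by
  simp_rw [pointCount_sub_one]
  rw [Finset.sum_comm, ← card_filter_mem hU, ← zero_add (_ * _), ← sum_filter_ite_zero]
  refine Finset.sum_congr rfl fun u _ => ?_
  split_ifs with hu
  · simp
  · rw [← sum_ite_mem_span hu, Finset.sum_filter]
    refine Finset.sum_congr rfl fun p _ => ?_
    simp only [mem_span_singleton_comm hu]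
    split_ifs <;> simp_all

lemma sum_pointCount_of_notMem (hU : Module.finrank F U = 2 * Module.finrank F K)
    (a : Fin 4 → K) :
    ∑ p with p ∉ perp a, ((pointCount U p : ℝ) - 1) =
      ((Nat.card K : ℝ) ^ 2 - planeCount U a) * (Nat.card K - 1) := by
  simp_rw [pointCount_sub_one]
  rw [Finset.sum_comm, ← card_filter_mem hU, planeCount_eq_sum, Finset.card_eq_sum_ones]
  push_cast
  rw [← Finset.sum_sub_distrib, Finset.sum_mul]
  refine Finset.sum_congr rfl fun u _ => ?_
  by_cases hu : u = 0
  · simp [hu]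
  simp only [if_neg hu]
  by_cases hua : u ∈ perp a
  · rw [if_pos hua, sub_self, zero_mul]
    refine Finset.sum_eq_zero fun p hp => if_neg fun hup => ?_
    have := (mem_span_singleton_comm hu).1 hup
    exact (Finset.mem_filter.1 hp).2
      ((Submodule.span_singleton_le_iff_mem _ _).2 hua this.2)
  · rw [if_neg hua, sub_zero, one_mul, ← sum_ite_mem_span hu, Finset.sum_filter]
    refine Finset.sum_congr rfl fun p _ => ?_
    simp only [← mem_span_singleton_comm hu]
    by_cases h2 : u ∈ Submodule.span K {p}
    · rw [if_pos h2, if_pos fun h1 => hua ((Submodule.span_singleton_le_iff_mem _ _).2 h1 h2)]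
    · simp only [if_neg h2, ite_self]

variable [Finite F]

lemma one_lt_natCard : (1 : ℝ) < Nat.card F := by
  exact_mod_cast Finite.one_lt_card

/-- A variance argument: a nonnegative quadratic in the plane count, with roots `Q` and `q Q`, has
total sum zero over the nonzero covectors. -/
lemma planeCount_eq_or (hU : Module.finrank F U = 2 * Module.finrank F K)
    (hs : IsScattered U) {a : Fin 4 → K} (ha : a ≠ 0) :
    planeCount U a = Nat.card K ∨ planeCount U a = Nat.card F * Nat.card K := by
  have hq := one_lt_natCard (F := F)
  have hpos : ∀ a, 0 ≤ ((planeCount U a : ℝ) - Nat.card K) *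
      (planeCount U a - Nat.card F * Nat.card K) := by
    intro a
    obtain ⟨d, hd, h⟩ := exists_planeCount_eq_pow hU a
    rcases hd.eq_or_lt with rfl | hd
    · rw [h, natCard_eq_pow (F := F) (K := K)]
      simp
    · have h1 : Nat.card F * Nat.card K ≤ planeCount U a := by
        rw [h, natCard_eq_pow (F := F) (K := K), ← pow_succ']
        exact Nat.pow_le_pow_right Nat.card_pos hd
      have h1 : (Nat.card F * Nat.card K : ℝ) ≤ planeCount U a := by exact_mod_cast h1
      have h2 : (0 : ℝ) ≤ Nat.card K := by positivity
      apply mul_nonneg <;> nlinarith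
  -- By the two moments, the sum over all covectors equals the contribution of `a = 0`, where the
  -- count is `Q ^ 2`.
  have hsum : ∑ a, ((planeCount U a : ℝ) - Nat.card K) *
      (planeCount U a - Nat.card F * Nat.card K) =
      ((planeCount U 0 : ℝ) - Nat.card K) * (planeCount U 0 - Nat.card F * Nat.card K) := by
    have h0 := planeCount_zero hU
    have h1 : ∀ a, ((planeCount U a : ℝ) - Nat.card K) *
      (planeCount U a - Nat.card F * Nat.card K) = (planeCount U a : ℝ) ^ 2 -
        (1 + Nat.card F) * Nat.card K * planeCount U a + Nat.card F * (Nat.card K : ℝ) ^ 2 := by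
      intro a; ring
    simp_rw [h1]
    rw [Finset.sum_add_distrib, Finset.sum_sub_distrib, ← Finset.mul_sum, sum_planeCount hU,
      sum_planeCount_sq hU hs, Finset.sum_const, nsmul_eq_mul, h0]
    have : ((univ : Finset (Fin 4 → K)).card : ℝ) = (Nat.card K : ℝ) ^ 4 := by
      simp
    rw [this]
    ring
  rw [← Finset.add_sum_erase univ _ (mem_univ (0 : Fin 4 → K)), add_eq_left,
    Finset.sum_eq_zero_iff_of_nonneg fun a _ => hpos a] at hsum
  have := hsum a (by simp [ha])
  rw [mul_eq_zero, sub_eq_zero, sub_eq_zero] at this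
  exact_mod_cast this

end Counting

/-! ### Disjointness of generators, and sums over generators and quadric points. -/

section Generators

open Finset Classical

variable {K : Type*} [Field K]

lemma contr_smul (x : Fin 6 → K) (c : K) (a : Fin 4 → K) : contr x (c • a) = c • contr x a := by
  ext i; fin_cases i <;> simp [contr] <;> ring

lemma latin_eq_latin_iff {p u : Fin 4 → K} (hp : p ≠ 0) (hu : u ≠ 0) :
    latin u = latin p ↔ u ∈ Submodule.span K {p} := by
  constructor
  · intro h
    by_contra hup
    have h1 := finrank_latin hp
    have h2 := latin_inf_latin hp hup
    rw [h, inf_idem] at h2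
    rw [h2, finrank_span_singleton (plucker_ne_zero hp hup)] at h1
    norm_num at h1
  · intro h
    obtain ⟨c, rfl⟩ := Submodule.mem_span_singleton.1 h
    have hc : c ≠ 0 := (smul_ne_zero_iff.1 hu).1
    ext x
    rw [mem_latin_iff hu, mem_latin_iff hp, contr_smul, smul_eq_zero, or_iff_right hc]

lemma greek_eq_greek_iff {a b : Fin 4 → K} (ha : a ≠ 0) (hb : b ≠ 0) :
    greek b = greek a ↔ b ∈ Submodule.span K {a} := by
  rw [← latin_eq_latin_iff ha hb]
  constructor
  · intro h
    ext x
    rw [← revEquiv_revEquiv x, rev_mem_latin ha, rev_mem_latin hb, h]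
  · intro h
    ext x
    rw [← rev_mem_latin ha, ← rev_mem_latin hb, h]

lemma finrank_latin_inf_greek_lt {p a : Fin 4 → K} (hp : p ≠ 0) (ha : a ≠ 0) :
    Module.finrank K (latin p ⊓ greek a : Submodule K (Fin 6 → K)) < 3 := by
  by_cases h : p ⬝ᵥ a = 0
  · rw [finrank_latin_inf_greek hp ha h]
    norm_num
  · rw [(disjoint_latin_greek h).eq_bot, finrank_bot]
    norm_num

lemma latin_ne_greek {p a : Fin 4 → K} (hp : p ≠ 0) (ha : a ≠ 0) : latin p ≠ greek a := by
  intro h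
  have h1 := finrank_latin_inf_greek_lt hp ha
  rw [← h, inf_idem, finrank_latin hp] at h1
  exact lt_irrefl _ h1

lemma not_disjoint_latin_latin {p u : Fin 4 → K} (hp : p ≠ 0) (hu : u ≠ 0) :
    ¬Disjoint (latin p) (latin u) := by
  intro h
  by_cases hup : u ∈ Submodule.span K {p}
  · rw [(latin_eq_latin_iff hp hu).2 hup, disjoint_self] at h
    have := finrank_latin hp
    rw [h, finrank_bot] at this
    norm_num at this
  · have h1 := latin_inf_latin hp hup
    rw [h.eq_bot, eq_comm, Submodule.span_singleton_eq_bot] at h1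
    exact plucker_ne_zero hp hup h1

lemma not_disjoint_greek_greek {a b : Fin 4 → K} (ha : a ≠ 0) (hb : b ≠ 0) :
    ¬Disjoint (greek a) (greek b) := by
  intro h
  apply not_disjoint_latin_latin ha hb
  rw [Submodule.disjoint_def] at h ⊢
  intro x hxa hxb
  rw [← revEquiv_revEquiv x] at hxa hxb
  rw [rev_mem_latin ha] at hxa
  rw [rev_mem_latin hb] at hxb
  simpa using h _ hxa hxb

lemma disjoint_latin_greek_iff {p a : Fin 4 → K} (hp : p ≠ 0) (ha : a ≠ 0) :
    Disjoint (latin p) (greek a) ↔ p ∉ perp a := by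
  refine ⟨fun h h0 => ?_, disjoint_latin_greek⟩
  have := finrank_latin_inf_greek hp ha h0
  rw [h.eq_bot, finrank_bot] at this
  norm_num at this

/-- The Latin plane of the point `⟨p⟩`. -/
def latinGen (p : {p : Fin 4 → K // p ≠ 0}) : Generator K :=
  ⟨⟨latin p.1, finrank_latin p.2⟩, isTotallySingular_latin p.1⟩

/-- The Greek plane of the plane `perp a`. -/
def greekGen (a : {a : Fin 4 → K // a ≠ 0}) : Generator K :=
  ⟨⟨greek a.1, finrank_greek a.2⟩, isTotallySingular_greek a.2⟩

lemma generator_ext_iff {G H : Generator K} : G = H ↔ G.1.1 = H.1.1 := by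
  rw [Subtype.ext_iff, Subtype.ext_iff]

lemma exists_eq_latinGen_or_greekGen (G : Generator K) :
    (∃ p, G = latinGen p) ∨ ∃ a, G = greekGen a := by
  rcases eq_latin_or_eq_greek G.2 G.1.2 with ⟨p, hp, h⟩ | ⟨a, ha, h⟩
  · exact Or.inl ⟨⟨p, hp⟩, generator_ext_iff.2 h⟩
  · exact Or.inr ⟨⟨a, ha⟩, generator_ext_iff.2 h⟩

lemma latinGen_eq_iff {p u : {p : Fin 4 → K // p ≠ 0}} :
    latinGen u = latinGen p ↔ u.1 ∈ Submodule.span K {p.1} := by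
  rw [generator_ext_iff]
  exact latin_eq_latin_iff p.2 u.2

lemma greekGen_eq_iff {a b : {p : Fin 4 → K // p ≠ 0}} :
    greekGen b = greekGen a ↔ b.1 ∈ Submodule.span K {a.1} := by
  rw [generator_ext_iff]
  exact greek_eq_greek_iff a.2 b.2

lemma latinGen_ne_greekGen (p a : {p : Fin 4 → K // p ≠ 0}) : latinGen p ≠ greekGen a :=
  fun h => latin_ne_greek p.2 a.2 (generator_ext_iff.1 h)

noncomputable instance [Finite K] : Fintype (Generator K) := Fintype.ofFinite _

variable [Fintype K]

lemma sum_ne_zero_eq {n : ℕ} (f : (Fin n → K) → ℝ) :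
    ∑ p : {p : Fin n → K // p ≠ 0}, f p.1 = ∑ p with p ≠ 0, f p :=
  (Finset.sum_subtype _ (by simp) f).symm

lemma card_filter_mem_span (p : {p : Fin 4 → K // p ≠ 0}) :
    ((univ.filter fun u : {p : Fin 4 → K // p ≠ 0} => u.1 ∈ Submodule.span K {p.1}).card : ℝ) =
      Nat.card K - 1 := by
  rw [← sum_ite_mem_span p.2, Finset.card_filter]
  push_cast
  rw [sum_ne_zero_eq (fun u => if u ∈ Submodule.span K {p.1} then (1 : ℝ) else 0),
    Finset.sum_filter]
  refine Finset.sum_congr rfl fun u _ => ?_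
  split_ifs <;> simp_all

/-- A sum over the generators as a sum over the points and planes of `PG(3, K)`. -/
lemma sum_generator (f : Generator K → ℝ) :
    ((Nat.card K : ℝ) - 1) * ∑ G, f G =
      ∑ p : {p : Fin 4 → K // p ≠ 0}, f (latinGen p) +
        ∑ a : {a : Fin 4 → K // a ≠ 0}, f (greekGen a) := by
  rw [← Finset.sum_fiberwise univ latinGen, ← Finset.sum_fiberwise univ greekGen,
    ← Finset.sum_add_distrib, Finset.mul_sum]
  refine Finset.sum_congr rfl fun G _ => ?_
  have h1 : ∀ g : {p : Fin 4 → K // p ≠ 0} → Generator K,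
      ∑ i with g i = G, f (g i) = (univ.filter fun i => g i = G).card * f G := by
    intro g
    rw [← nsmul_eq_mul, ← Finset.sum_const]
    refine Finset.sum_congr rfl fun i hi => ?_
    rw [(Finset.mem_filter.1 hi).2]
  rw [h1, h1, ← add_mul]
  congr 1
  -- A generator belongs to exactly one family and is reached there from the `Q - 1` nonzero
  -- multiples of one vector.
  rcases exists_eq_latinGen_or_greekGen G with ⟨p, rfl⟩ | ⟨a, rfl⟩
  · simp_rw [latinGen_eq_iff]
    rw [card_filter_mem_span, Finset.filter_false_of_mem
      fun a _ h => latinGen_ne_greekGen p a h.symm]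
    simp
  · simp_rw [greekGen_eq_iff]
    rw [card_filter_mem_span, Finset.filter_false_of_mem fun p _ h => latinGen_ne_greekGen p a h]
    simp

/-- The number of points of a subspace of the Klein quadric. -/
lemma sum_quadricPoint_le {W : Submodule K (Fin 6 → K)} (hW : IsTotallySingular W) :
    ((Nat.card K : ℝ) - 1) * ∑ X : QuadricPoint K, (if X.1.1 ≤ W then (1 : ℝ) else 0) =
      (Nat.card K : ℝ) ^ Module.finrank K W - 1 := by
  have h1 : ∀ X : QuadricPoint K, ((Nat.card K : ℝ) - 1) * (if X.1.1 ≤ W then (1 : ℝ) else 0) =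
      ∑ x, if x ≠ 0 ∧ x ∈ X.1.1 ∧ X.1.1 ≤ W then 1 else 0 := by
    intro X
    obtain ⟨y, hy, hX⟩ := exists_eq_span_singleton X.1
    by_cases h : X.1.1 ≤ W
    · simp only [h, if_true, and_true, mul_one]
      rw [hX, sum_ite_mem_span hy]
    · simp [h]
  rw [Finset.mul_sum, Finset.sum_congr rfl fun X _ => h1 X, Finset.sum_comm,
    ← sum_ite_mem_submodule W, ← Finset.add_sum_erase univ _ (mem_univ (0 : Fin 6 → K)),
    ← Finset.add_sum_erase univ (fun x => if x ∈ W then (1 : ℝ) else 0)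
      (mem_univ (0 : Fin 6 → K))]
  rw [if_pos (zero_mem _), add_sub_cancel_left]
  simp only [ne_eq, not_true_eq_false, false_and, if_false, Finset.sum_const_zero, zero_add]
  refine Finset.sum_congr rfl fun x hx => ?_
  have hx0 := Finset.ne_of_mem_erase hx
  split_ifs with hxW
  · rw [Finset.sum_eq_single (mkQuadricPoint x hx0 (hW x hxW))]
    · refine if_pos ⟨hx0, Submodule.mem_span_singleton_self x, ?_⟩
      exact (Submodule.span_singleton_le_iff_mem _ _).2 hxW
    · intro X _ hX
      refine if_neg fun h => hX ?_
      rw [Subtype.ext_iff, Subtype.ext_iff]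
      refine (Submodule.eq_of_le_of_finrank_eq
        ((Submodule.span_singleton_le_iff_mem _ _).2 h.2.1) ?_).symm
      rw [X.1.2, finrank_span_singleton hx0]
    · simp
  · exact Finset.sum_eq_zero fun X _ => if_neg fun h => hxW (h.2.2 h.2.1)

end Generators

/-! ### The Cameron-Liebler properties of the set defined by a scattered subspace. -/

section CameronLiebler

open Finset Classical

variable {K : Type*} [Field K] {F : Type*} [Field F] [Algebra F K] {U : Submodule F (Fin 4 → K)}

lemma charVec_apply (L : Set (Generator K)) (G : Generator K) :
    charVec L G = if G ∈ L then 1 else 0 := by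
  unfold charVec
  rw [Set.indicator_apply]

lemma span_singleton_eq_iff {n : ℕ} {u p : Fin n → K} (hu : u ≠ 0) (hp : p ≠ 0) :
    Submodule.span K {u} = Submodule.span K {p} ↔ u ∈ Submodule.span K {p} := by
  constructor
  · intro h
    rw [← h]
    exact Submodule.mem_span_singleton_self u
  · intro h
    refine Submodule.eq_of_le_of_finrank_eq ((Submodule.span_singleton_le_iff_mem _ _).2 h) ?_
    rw [finrank_span_singleton hu, finrank_span_singleton hp]

lemma latinGen_mem_kleinSet (P₂ : Set (ProjSub K 3 2)) (p : {p : Fin 4 → K // p ≠ 0}) :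
    latinGen p ∈ kleinSet (linearSet F U) P₂ ↔
      ∃ u ∈ U, u ≠ 0 ∧ u ∈ Submodule.span K {p.1} := by
  constructor
  · rintro (⟨P, ⟨u, huU, hu, hP⟩, h⟩ | ⟨π, -, h⟩)
    · rw [isLatinPlaneOf_iff hu hP] at h
      have h : latin p.1 = latin u := h
      exact ⟨u, huU, hu, (latin_eq_latin_iff p.2 hu).1 h.symm⟩
    · obtain ⟨a, ha, hπ⟩ := exists_eq_perp π
      rw [isGreekPlaneOf_iff ha hπ] at h
      exact absurd h (latin_ne_greek p.2 ha)
  · rintro ⟨u, huU, hu, hup⟩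
    refine Or.inl ⟨⟨Submodule.span K {u}, finrank_span_singleton hu⟩, ⟨u, huU, hu, rfl⟩, ?_⟩
    rw [isLatinPlaneOf_iff hu rfl]
    exact ((latin_eq_latin_iff p.2 hu).2 hup).symm

lemma perp_smul {c : K} (hc : c ≠ 0) (a : Fin 4 → K) : perp (c • a) = perp a := by
  ext u
  rw [mem_perp, mem_perp, dotProduct_smul, smul_eq_zero, or_iff_right hc]

lemma greekGen_mem_kleinSet (S : Set (ProjSub K 3 0)) (P₂ : Set (ProjSub K 3 2))
    (a : {a : Fin 4 → K // a ≠ 0}) :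
    greekGen a ∈ kleinSet S P₂ ↔ (⟨perp a.1, finrank_perp a.2⟩ : ProjSub K 3 2) ∈ P₂ := by
  constructor
  · rintro (⟨P, -, h⟩ | ⟨π, hπ₂, h⟩)
    · obtain ⟨p, hp, hP⟩ := exists_eq_span_singleton P
      rw [isLatinPlaneOf_iff hp hP] at h
      exact absurd h.symm (latin_ne_greek hp a.2)
    · obtain ⟨b, hb, hπ⟩ := exists_eq_perp π
      rw [isGreekPlaneOf_iff hb hπ] at h
      have h : greek a.1 = greek b := h
      rw [greek_eq_greek_iff hb a.2] at h
      obtain ⟨c, hc⟩ := Submodule.mem_span_singleton.1 h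
      have hc0 : c ≠ 0 := by
        rintro rfl
        exact a.2 (by rw [← hc, zero_smul])
      convert hπ₂
      rw [hπ, ← hc, perp_smul hc0]
  · intro h
    exact Or.inr ⟨_, h, (isGreekPlaneOf_iff a.2 rfl _).2 rfl⟩

variable [Fintype K]

lemma pointCount_eq_ite (hs : IsScattered U) (p : {p : Fin 4 → K // p ≠ 0}) :
    pointCount U p.1 =
      if ∃ u ∈ U, u ≠ 0 ∧ u ∈ Submodule.span K {p.1} then Nat.card F else 1 := by
  split_ifs with h
  · obtain ⟨u, huU, hu, hup⟩ := h
    exact pointCount_of_mem hs p.2 hu huU hup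
  · push Not at h
    exact pointCount_of_forall fun u huU hup => by_contra fun hu => h u huU hu hup

/-- The number of vectors `u ≠ 0` of `U` such that `X` lies in the Latin plane of `⟨u⟩`. -/
noncomputable def latinWeight (U : Submodule F (Fin 4 → K)) (X : QuadricPoint K) : ℝ :=
  ∑ u with u ∈ U, if u = 0 then 0 else if X.1.1 ≤ latin u then 1 else 0

lemma sum_latinWeight (U : Submodule F (Fin 4 → K)) (G : Generator K) :
    ((Nat.card K : ℝ) - 1) * ∑ X : QuadricPoint K,
        (if X.1.1 ≤ G.1.1 then (1 : ℝ) else 0) * latinWeight U X =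
      ∑ u with u ∈ U, if u = 0 then 0 else
        (Nat.card K : ℝ) ^ Module.finrank K (G.1.1 ⊓ latin u : Submodule K (Fin 6 → K)) - 1 := by
  simp_rw [latinWeight, Finset.mul_sum]
  rw [Finset.sum_comm]
  refine Finset.sum_congr rfl fun u _ => ?_
  split_ifs with hu
  · simp
  · rw [← sum_quadricPoint_le (W := G.1.1 ⊓ latin u) fun x hx => G.2 x hx.1, Finset.mul_sum]
    refine Finset.sum_congr rfl fun X _ => ?_
    simp only [le_inf_iff]
    split_ifs <;> simp_all

lemma sum_latinWeight_latinGen (hU : Module.finrank F U = 2 * Module.finrank F K)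
    (p : {p : Fin 4 → K // p ≠ 0}) :
    ((Nat.card K : ℝ) - 1) * ∑ X : QuadricPoint K,
        (if X.1.1 ≤ (latinGen p).1.1 then (1 : ℝ) else 0) * latinWeight U X =
      ((Nat.card K : ℝ) - 1) * ((Nat.card K : ℝ) ^ 2 - 1) +
        (pointCount U p.1 - 1) * ((Nat.card K : ℝ) ^ 3 - Nat.card K) := by
  -- A Latin plane different from that of `p` contributes the `Q - 1` nonzero vectors of one point;
  -- when the two coincide the contribution is `Q ^ 3 - 1`, an excess of `Q ^ 3 - Q`.
  have h1 : ∀ u : Fin 4 → K, (if u = 0 then 0 else (Nat.card K : ℝ) ^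
      Module.finrank K ((latinGen p).1.1 ⊓ latin u : Submodule K (Fin 6 → K)) - 1) =
      (if u = 0 then 0 else (Nat.card K : ℝ) - 1) +
      (if u = 0 then 0 else if u ∈ Submodule.span K {p.1} then 1 else 0) *
        ((Nat.card K : ℝ) ^ 3 - Nat.card K) := by
    intro u
    change (if u = 0 then 0 else (Nat.card K : ℝ) ^
      Module.finrank K (latin p.1 ⊓ latin u : Submodule K (Fin 6 → K)) - 1) = _
    split_ifs with hu hup
    · ring
    · rw [(latin_eq_latin_iff p.2 hu).2 hup, inf_idem, finrank_latin p.2]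
      ring
    · rw [latin_inf_latin p.2 hup, finrank_span_singleton (plucker_ne_zero p.2 hup)]
      ring
  rw [sum_latinWeight, Finset.sum_congr rfl fun u _ => h1 u, Finset.sum_add_distrib,
    sum_filter_ite_zero, card_filter_mem hU, ← Finset.sum_mul, ← pointCount_sub_one]
  ring

lemma sum_latinWeight_greekGen (a : {a : Fin 4 → K // a ≠ 0}) :
    ((Nat.card K : ℝ) - 1) * ∑ X : QuadricPoint K,
        (if X.1.1 ≤ (greekGen a).1.1 then (1 : ℝ) else 0) * latinWeight U X =
      (planeCount U a.1 - 1) * ((Nat.card K : ℝ) ^ 2 - 1) := by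
  have h1 : ∀ u : Fin 4 → K, (if u = 0 then 0 else (Nat.card K : ℝ) ^
      Module.finrank K ((greekGen a).1.1 ⊓ latin u : Submodule K (Fin 6 → K)) - 1) =
      ((if u ∈ perp a.1 then 1 else 0) - if u = 0 then 1 else 0) * ((Nat.card K : ℝ) ^ 2 - 1) := by
    intro u
    change (if u = 0 then 0 else (Nat.card K : ℝ) ^
      Module.finrank K (greek a.1 ⊓ latin u : Submodule K (Fin 6 → K)) - 1) = _
    by_cases hu : u = 0
    · simp [hu]
    · rw [if_neg hu, if_neg hu, inf_comm]
      split_ifs with hua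
      · rw [finrank_latin_inf_greek hu a.2 hua]
        ring
      · rw [((disjoint_latin_greek_iff hu a.2).2 hua).eq_bot, finrank_bot]
        ring
  rw [sum_latinWeight, Finset.sum_congr rfl fun u _ => h1 u, ← Finset.sum_mul,
    Finset.sum_sub_distrib, ← planeCount_eq_sum, Finset.sum_ite_eq', if_pos (by simp)]

/-- Counting the points of a scattered linear set in a plane. -/
lemma ncard_linearSet_le_perp (hs : IsScattered U) (a : Fin 4 → K) :
    {P ∈ linearSet F U | P.1 ≤ perp a}.ncard * (Nat.card F - 1) + 1 = planeCount U a := by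
  set s : Finset (Fin 4 → K) := univ.filter fun u => u ∈ U ∧ u ∈ perp a with hsdef
  have hs0 : (0 : Fin 4 → K) ∈ s := by simp [hsdef]
  have hcard : planeCount U a = s.card := by
    unfold planeCount
    rw [Nat.card_eq_fintype_card, Fintype.card_subtype]
    congr 1
    ext u
    simp [hsdef]
  have himg : (fun P : ProjSub K 3 0 => P.1) '' {P ∈ linearSet F U | P.1 ≤ perp a} =
      (((s.erase 0).image fun u => Submodule.span K {u} : Finset (Submodule K (Fin 4 → K))) :
        Set (Submodule K (Fin 4 → K))) := by
    ext W
    simp only [Set.mem_image, Set.mem_ofPred_eq, coe_image, coe_erase, Set.mem_sdiff, mem_coe,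
      hsdef, mem_filter, mem_univ, true_and, Set.mem_singleton_iff]
    constructor
    · rintro ⟨P, ⟨⟨u, huU, hu, hP⟩, hPa⟩, rfl⟩
      rw [hP, Submodule.span_singleton_le_iff_mem] at hPa
      exact ⟨u, ⟨⟨huU, hPa⟩, hu⟩, hP.symm⟩
    · rintro ⟨u, ⟨⟨huU, hua⟩, hu⟩, rfl⟩
      exact ⟨⟨Submodule.span K {u}, finrank_span_singleton hu⟩, ⟨⟨u, huU, hu, rfl⟩,
        (Submodule.span_singleton_le_iff_mem _ _).2 hua⟩, rfl⟩
  rw [← Set.ncard_image_of_injective _ Subtype.val_injective, himg, Set.ncard_coe_finset,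
    hcard, ← Finset.card_erase_add_one hs0, Finset.card_eq_sum_card_image
    (fun u => Submodule.span K {u}) (s.erase 0), ← smul_eq_mul, ← Finset.sum_const]
  congr 1
  -- The fibre of `u ↦ ⟨u⟩` over a point of the linear set consists of the `q - 1` nonzero vectors
  -- of `U` in that point.
  refine Finset.sum_congr rfl fun W hW => ?_
  obtain ⟨p, hp, rfl⟩ := Finset.mem_image.1 hW
  have hp0 := Finset.ne_of_mem_erase hp
  have hp := Finset.mem_of_mem_erase hp
  rw [hsdef, Finset.mem_filter] at hp
  have h1 := pointCount_of_mem hs hp0 hp0 hp.2.1 (Submodule.mem_span_singleton_self p)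
  have h2 : pointCount U p = (univ.filter fun u => u ∈ U ∧ u ∈ Submodule.span K {p}).card := by
    unfold pointCount
    rw [Nat.card_eq_fintype_card, Fintype.card_subtype]
    congr 1
    ext u
    simp
  rw [← h1, h2, ← Finset.card_erase_of_mem (a := (0 : Fin 4 → K)) (by simp)]
  congr 1
  ext u
  simp only [mem_erase, mem_filter, mem_univ, true_and, hsdef]
  constructor
  · rintro ⟨hu, huU, hup⟩
    exact ⟨⟨hu, huU, (Submodule.span_singleton_le_iff_mem _ _).2 hp.2.2 hup⟩,
      (span_singleton_eq_iff hu hp0).2 hup⟩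
  · rintro ⟨⟨hu, huU, -⟩, h⟩
    exact ⟨hu, huU, (span_singleton_eq_iff hu hp0).1 h⟩

variable (U) in
/-- The generators of the Klein quadric determined by a scattered linear set. -/
noncomputable def clSet : Set (Generator K) :=
  kleinSet (linearSet F U)
    (planesMeetingIn (linearSet F U) (theta (Module.finrank F K) (Nat.card F)))

/-- Scatteredness makes `pointCount` equal to `q` on points of the linear set and `1` off it, so the
indicator is affine in the count. -/
lemma charVec_latinGen (hs : IsScattered U) (p : {p : Fin 4 → K // p ≠ 0}) :
    charVec (clSet U) (latinGen p) * ((Nat.card F : ℝ) - 1) = pointCount U p.1 - 1 := by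
  rw [charVec_apply, pointCount_eq_ite hs, clSet]
  simp only [latinGen_mem_kleinSet]
  split_ifs <;> simp

variable [Finite F]

lemma theta_mul (n q : ℕ) (hq : 1 ≤ q) : theta n q * (q - 1) + 1 = q ^ (n + 1) := by
  unfold theta
  zify [hq]
  rw [geom_sum_mul]
  ring

lemma mem_planesMeetingIn_iff (hs : IsScattered U) {a : Fin 4 → K} (ha : a ≠ 0) :
    (⟨perp a, finrank_perp ha⟩ : ProjSub K 3 2) ∈
      planesMeetingIn (linearSet F U) (theta (Module.finrank F K) (Nat.card F)) ↔
      planeCount U a = Nat.card F * Nat.card K := by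
  have hq : 1 < Nat.card F := Finite.one_lt_card
  rw [natCard_eq_pow (F := F) (K := K), ← pow_succ', ← theta_mul _ _ hq.le,
    ← ncard_linearSet_le_perp hs]
  rw [Nat.add_right_cancel_iff, Nat.mul_left_inj (by omega)]
  rfl

/-- With only the values `Q` and `q Q` available, the indicator of the larger one is affine in the
count. -/
lemma charVec_greekGen (hU : Module.finrank F U = 2 * Module.finrank F K) (hs : IsScattered U)
    (a : {a : Fin 4 → K // a ≠ 0}) :
    charVec (clSet U) (greekGen a) * (((Nat.card F : ℝ) - 1) * Nat.card K) =
      planeCount U a.1 - Nat.card K := by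
  rw [charVec_apply, clSet]
  simp only [greekGen_mem_kleinSet, mem_planesMeetingIn_iff hs a.2]
  split_ifs with h
  · rw [h]
    push_cast
    ring
  · rw [(planeCount_eq_or hU hs a.2).resolve_right h]
    ring

lemma sum_charVec (hU : Module.finrank F U = 2 * Module.finrank F K) (hs : IsScattered U) :
    ((Nat.card F : ℝ) - 1) * ∑ G, charVec (clSet U) G = 2 * ((Nat.card K : ℝ) ^ 2 - 1) := by
  have hq := one_lt_natCard (F := F)
  have hQ := one_lt_natCard (F := K)
  have h := sum_generator (charVec (clSet U))
  have h1 : (∑ p : {p : Fin 4 → K // p ≠ 0}, charVec (clSet U) (latinGen p)) *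
      ((Nat.card F : ℝ) - 1) = ((Nat.card K : ℝ) ^ 2 - 1) * (Nat.card K - 1) := by
    rw [← sum_pointCount hU, ← sum_ne_zero_eq (fun p => (pointCount U p : ℝ) - 1),
      Finset.sum_mul]
    exact Finset.sum_congr rfl fun p _ => charVec_latinGen hs p
  have h2 : (∑ a : {a : Fin 4 → K // a ≠ 0}, charVec (clSet U) (greekGen a)) *
      (((Nat.card F : ℝ) - 1) * Nat.card K) =
      (((Nat.card K : ℝ) ^ 2 - 1) * (Nat.card K - 1)) * Nat.card K := by
    rw [Finset.sum_mul, Finset.sum_congr rfl fun a _ => charVec_greekGen hU hs a,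
      sum_ne_zero_eq (fun a => (planeCount U a : ℝ) - Nat.card K), Finset.filter_ne',
      Finset.sum_erase_eq_sub (mem_univ _), Finset.sum_sub_distrib, sum_planeCount hU,
      Finset.sum_const, nsmul_eq_mul]
    have h0 := planeCount_zero hU
    have h3 : ((univ : Finset (Fin 4 → K)).card : ℝ) = (Nat.card K : ℝ) ^ 4 := by
      simp
    rw [h0, h3]
    ring
  rw [← mul_assoc] at h2
  have h2 := mul_right_cancel₀ (by positivity) h2
  have hQ1 : (Nat.card K : ℝ) - 1 ≠ 0 := by linarith
  refine mul_left_cancel₀ hQ1 ?_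
  linear_combination ((Nat.card F : ℝ) - 1) * h + h1 + h2

/-- Only generators of opposite families can be disjoint, and then exactly when point and plane are
not incident. The count is thus a sum of an affine function of vector counts over the non-incident
elements of the other family. -/
lemma isCameronLiebler_clSet (hU : Module.finrank F U = 2 * Module.finrank F K)
    (hs : IsScattered U) :
    IsCameronLiebler (clSet U) (((Nat.card K : ℝ) - 1) / (Nat.card F - 1)) := by
  have hq := one_lt_natCard (F := F)
  have hQ := one_lt_natCard (F := K)
  have hq1 : (Nat.card F : ℝ) - 1 ≠ 0 := by linarith
  have hQ1 : (Nat.card K : ℝ) - 1 ≠ 0 := by linarith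
  have hQ0 : (Nat.card K : ℝ) ≠ 0 := by linarith
  intro π
  have hn : ({G ∈ clSet U | Disjoint G.1.1 π.1.1}.ncard : ℝ) =
      ∑ G, if Disjoint G.1.1 π.1.1 then charVec (clSet U) G else 0 := by
    rw [← Nat.card_coe_set_eq, ← sum_ite_eq_natCard]
    refine Finset.sum_congr rfl fun G _ => ?_
    rw [charVec_apply, Set.mem_ofPred_eq]
    split_ifs <;> simp_all
  have h := sum_generator fun G => if Disjoint G.1.1 π.1.1 then charVec (clSet U) G else 0
  rw [← hn] at h
  rw [Nat.choose_self, pow_one]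
  rcases exists_eq_latinGen_or_greekGen π with ⟨p, rfl⟩ | ⟨a, rfl⟩
  · have h1 : ∑ u : {p : Fin 4 → K // p ≠ 0}, (if Disjoint (latinGen u).1.1 (latinGen p).1.1
        then charVec (clSet U) (latinGen u) else 0) = 0 :=
      Finset.sum_eq_zero fun u _ => if_neg (not_disjoint_latin_latin u.2 p.2)
    have h2 : (∑ a : {p : Fin 4 → K // p ≠ 0}, (if Disjoint (greekGen a).1.1 (latinGen p).1.1
        then charVec (clSet U) (greekGen a) else 0)) * (((Nat.card F : ℝ) - 1) * Nat.card K) =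
        (Nat.card K : ℝ) ^ 2 * (Nat.card K - 1) * (Nat.card K - pointCount U p.1) := by
      have e1 : ∀ a : {p : Fin 4 → K // p ≠ 0},
          (if Disjoint (greekGen a).1.1 (latinGen p).1.1
            then charVec (clSet U) (greekGen a) else 0) * (((Nat.card F : ℝ) - 1) * Nat.card K) =
          (1 - if p.1 ∈ perp a.1 then 1 else 0) * (planeCount U a.1 - Nat.card K) := by
        intro a
        have hd : Disjoint (greekGen a).1.1 (latinGen p).1.1 ↔ p.1 ∉ perp a.1 := by
          rw [disjoint_comm]
          exact disjoint_latin_greek_iff p.2 a.2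
        rw [← charVec_greekGen hU hs]
        by_cases hpa : p.1 ∈ perp a.1
        · rw [if_neg (by rw [hd]; exact not_not.2 hpa), if_pos hpa]
          ring
        · rw [if_pos (hd.2 hpa), if_neg hpa]
          ring
      rw [Finset.sum_mul, Finset.sum_congr rfl fun a _ => e1 a,
        sum_ne_zero_eq (fun a => (1 - if p.1 ∈ perp a then 1 else 0) *
          ((planeCount U a : ℝ) - Nat.card K)), Finset.filter_ne',
        -- The covector `a = 0` can be included in the sum, since `p ∈ perp 0` makes its term
        -- vanish.
        Finset.sum_erase _ (by simp [mem_perp])]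
      have e2 : ∀ a, (1 - if p.1 ∈ perp a then 1 else 0) * ((planeCount U a : ℝ) - Nat.card K) =
          (planeCount U a : ℝ) - (if p.1 ∈ perp a then (1 : ℝ) else 0) * planeCount U a -
            Nat.card K + (if p.1 ∈ perp a then (1 : ℝ) else 0) * Nat.card K := by
        intro a; ring
      simp_rw [e2]
      rw [Finset.sum_add_distrib, Finset.sum_sub_distrib, Finset.sum_sub_distrib,
        sum_planeCount hU, sum_planeCount_of_mem hU p.2, ← Finset.sum_mul, sum_mem_perp,
        if_neg p.2, Finset.sum_const, nsmul_eq_mul]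
      have h3 : ((univ : Finset (Fin 4 → K)).card : ℝ) = (Nat.card K : ℝ) ^ 4 := by
        simp
      rw [h3]
      ring
    rw [h1, zero_add] at h
    have h3 := charVec_latinGen hs p
    rw [← h] at h2
    rw [div_sub' hq1, div_mul_eq_mul_div, eq_div_iff hq1]
    refine mul_left_cancel₀ (mul_ne_zero hQ0 hQ1) ?_
    linear_combination h2 + (Nat.card K : ℝ) ^ 2 * (Nat.card K - 1) * h3
  · have h1 : ∑ u : {p : Fin 4 → K // p ≠ 0}, (if Disjoint (greekGen u).1.1 (greekGen a).1.1
        then charVec (clSet U) (greekGen u) else 0) = 0 :=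
      Finset.sum_eq_zero fun u _ => if_neg (not_disjoint_greek_greek u.2 a.2)
    have h2 : (∑ p : {p : Fin 4 → K // p ≠ 0}, (if Disjoint (latinGen p).1.1 (greekGen a).1.1
        then charVec (clSet U) (latinGen p) else 0)) * ((Nat.card F : ℝ) - 1) =
        ((Nat.card K : ℝ) ^ 2 - planeCount U a.1) * (Nat.card K - 1) := by
      have e1 : ∀ p : {p : Fin 4 → K // p ≠ 0},
          (if Disjoint (latinGen p).1.1 (greekGen a).1.1
            then charVec (clSet U) (latinGen p) else 0) * ((Nat.card F : ℝ) - 1) =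
          if p.1 ∉ perp a.1 then (pointCount U p.1 : ℝ) - 1 else 0 := by
        intro p
        have hd : Disjoint (latinGen p).1.1 (greekGen a).1.1 ↔ p.1 ∉ perp a.1 :=
          disjoint_latin_greek_iff p.2 a.2
        rw [← charVec_latinGen hs]
        by_cases hpa : p.1 ∈ perp a.1
        · rw [if_neg (by rw [hd]; exact not_not.2 hpa), if_neg (not_not.2 hpa), zero_mul]
        · rw [if_pos (hd.2 hpa), if_pos hpa]
      rw [Finset.sum_mul, Finset.sum_congr rfl fun a _ => e1 a,
        sum_ne_zero_eq (fun p => if p ∉ perp a.1 then (pointCount U p : ℝ) - 1 else 0),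
        Finset.filter_ne', Finset.sum_erase _ (by simp), ← Finset.sum_filter,
        sum_pointCount_of_notMem hU]
    rw [h1, add_zero] at h
    have h3 := charVec_greekGen hU hs a
    rw [← h] at h2
    rw [div_sub' hq1, div_mul_eq_mul_div, eq_div_iff hq1]
    refine mul_left_cancel₀ hQ1 ?_
    linear_combination h2 + (Nat.card K - 1) * h3

lemma charVec_clSet_mem_range (hU : Module.finrank F U = 2 * Module.finrank F K)
    (hs : IsScattered U) :
    charVec (clSet U) ∈ LinearMap.range (incidence K).transpose.mulVecLin := by
  have hq := one_lt_natCard (F := F)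
  have hQ := one_lt_natCard (F := K)
  have hq1 : (Nat.card F : ℝ) - 1 ≠ 0 := by linarith
  have hQ1 : (Nat.card K : ℝ) - 1 ≠ 0 := by linarith
  have hQ0 : (Nat.card K : ℝ) ≠ 0 := by linarith
  have hQ2 : (Nat.card K : ℝ) + 1 ≠ 0 := by linarith
  have hQ3 : (Nat.card K : ℝ) ^ 2 + Nat.card K + 1 ≠ 0 := by positivity
  -- A generator has `Q ^ 2 + Q + 1` points, so subtracting `c` from each weight lowers every
  -- generator sum by `Q ^ 2 - 1`. What remains is `(m(p) - 1) Q (Q + 1)` on Latin planes and `(n(a)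
  -- - Q) (Q + 1)` on Greek planes; `d` is the common scalar turning both into the characteristic
  -- function.
  set c : ℝ := ((Nat.card K : ℝ) ^ 2 - 1) / ((Nat.card K : ℝ) ^ 2 + Nat.card K + 1) with hc
  have hc' : c * ((Nat.card K : ℝ) ^ 2 + Nat.card K + 1) = (Nat.card K : ℝ) ^ 2 - 1 :=
    div_mul_cancel₀ _ hQ3
  set d : ℝ := (Nat.card F - 1) * (Nat.card K * (Nat.card K + 1)) with hd
  have hd0 : d ≠ 0 := mul_ne_zero hq1 (mul_ne_zero hQ0 hQ2)
  refine ⟨fun X => (latinWeight U X - c) / d, ?_⟩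
  ext G
  have h1 : (incidence K).transpose.mulVecLin (fun X => (latinWeight U X - c) / d) G =
      (∑ X : QuadricPoint K, (if X.1.1 ≤ G.1.1 then (1 : ℝ) else 0) * latinWeight U X -
        c * ∑ X : QuadricPoint K, (if X.1.1 ≤ G.1.1 then (1 : ℝ) else 0)) / d := by
    rw [Finset.mul_sum, ← Finset.sum_sub_distrib, Finset.sum_div]
    refine Finset.sum_congr rfl fun X _ => ?_
    simp only [incidence, Matrix.transpose_apply, Matrix.of_apply]
    ring
  have h2 := sum_quadricPoint_le G.2
  rw [G.1.2] at h2
  rw [h1, div_eq_iff hd0]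
  refine mul_left_cancel₀ hQ1 ?_
  rcases exists_eq_latinGen_or_greekGen G with ⟨p, rfl⟩ | ⟨a, rfl⟩
  · have h3 := sum_latinWeight_latinGen hU p
    have h4 := charVec_latinGen hs p
    rw [hd]
    linear_combination h3 - c * h2 - (Nat.card K - 1) * hc' -
      (Nat.card K - 1) * (Nat.card K * (Nat.card K + 1)) * h4
  · have h3 := sum_latinWeight_greekGen (U := U) a
    have h4 := charVec_greekGen hU hs a
    rw [hd]
    linear_combination h3 - c * h2 - (Nat.card K - 1) * hc' -
      (Nat.card K - 1) * (Nat.card K + 1) * h4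

lemma isDegreeOneCameronLiebler_clSet (hU : Module.finrank F U = 2 * Module.finrank F K)
    (hs : IsScattered U) :
    IsDegreeOneCameronLiebler (clSet U) (((Nat.card K : ℝ) - 1) / (Nat.card F - 1)) := by
  refine ⟨charVec_clSet_mem_range hU hs, ?_⟩
  have hq := one_lt_natCard (F := F)
  have hq1 : (Nat.card F : ℝ) - 1 ≠ 0 := by linarith
  have h := sum_charVec hU hs
  simp_rw [charVec_apply] at h
  rw [sum_ite_eq_natCard, Nat.card_coe_set_eq] at h
  rw [div_mul_eq_mul_div, eq_div_iff hq1, mul_comm, h]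
  simp [Finset.prod_range_succ]
  ring

end CameronLiebler

/-! ### Scalars fixed by Frobenius, and existence of scattered linear sets of rank `2t`. -/

section Frobenius

variable {F K : Type*} [Field F] [Finite F] [Field K] [Algebra F K]

variable (F) in
lemma add_pow_natCard (x y : K) : (x + y) ^ Nat.card F = x ^ Nat.card F + y ^ Nat.card F := by
  have := Fintype.ofFinite F
  rw [Nat.card_eq_fintype_card]
  exact map_add (FiniteField.frobeniusAlgHom F K) x y

lemma algebraMap_pow_natCard (c : F) :
    (algebraMap F K c) ^ Nat.card F = algebraMap F K c := by
  have := Fintype.ofFinite F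
  rw [Nat.card_eq_fintype_card, ← map_pow, FiniteField.pow_card]

/-- An element fixed by the Frobenius map of `F` lies in `F`. -/
lemma exists_algebraMap_eq_of_pow_eq {x : K} (hx : x ^ Nat.card F = x) :
    ∃ c, algebraMap F K c = x := by
  classical
  have := Fintype.ofFinite F
  have hq : 1 < Nat.card F := Finite.one_lt_card
  have h0 : (Polynomial.X ^ Nat.card F - Polynomial.X : Polynomial K) ≠ 0 :=
    FiniteField.X_pow_card_sub_X_ne_zero K hq
  set s := (Polynomial.X ^ Nat.card F - Polynomial.X : Polynomial K).roots.toFinset with hs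
  have hmem : ∀ y : K, y ∈ s ↔ y ^ Nat.card F = y := by
    intro y
    rw [hs, Multiset.mem_toFinset, Polynomial.mem_roots h0]
    simp [Polynomial.IsRoot, sub_eq_zero, -Nat.card_eq_fintype_card]
  have hsub : Finset.univ.image (algebraMap F K) ⊆ s := by
    intro y hy
    obtain ⟨c, -, rfl⟩ := Finset.mem_image.1 hy
    exact (hmem _).2 (algebraMap_pow_natCard c)
  have hcard : s.card ≤ (Finset.univ.image (algebraMap F K)).card := by
    rw [Finset.card_image_of_injective _ (algebraMap F K).injective, Finset.card_univ,
      ← Nat.card_eq_fintype_card, ← FiniteField.X_pow_card_sub_X_natDegree_eq K hq]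
    exact (Multiset.toFinset_card_le _).trans (Polynomial.card_roots' _)
  have h := (hmem x).2 hx
  rw [← Finset.eq_of_subset_of_card_le hsub hcard] at h
  obtain ⟨c, -, hc⟩ := Finset.mem_image.1 h
  exact ⟨c, hc⟩

/-- The scalars fixed by `c ↦ c ^ q` are those of `F`, so any two vectors of `U` in one point are
`F`-proportional. -/
lemma isScattered_of_forall {U : Submodule F (Fin 4 → K)}
    (h : ∀ u ∈ U, u ≠ 0 → ∀ c : K, c • u ∈ U → c ^ Nat.card F = c) : IsScattered U := by
  intro P
  obtain ⟨p, hp, hP⟩ := exists_eq_span_singleton P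
  by_cases h0 : ∃ u ∈ U ⊓ P.1.restrictScalars F, u ≠ 0
  · obtain ⟨u, hu, hu0⟩ := h0
    refine finrank_le_one ⟨u, hu⟩ fun w => ?_
    have hup : u ∈ Submodule.span K {p} := hP ▸ hu.2
    have hwp : w.1 ∈ Submodule.span K {p} := hP ▸ w.2.2
    rw [← (span_singleton_eq_iff hu0 hp).2 hup] at hwp
    obtain ⟨c, hc⟩ := Submodule.mem_span_singleton.1 hwp
    obtain ⟨d, rfl⟩ := exists_algebraMap_eq_of_pow_eq (h u hu.1 hu0 c (hc ▸ w.2.1))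
    refine ⟨d, Subtype.ext ?_⟩
    rw [← hc]
    exact (algebraMap_smul K d u).symm
  · push Not at h0
    rw [(Submodule.eq_bot_iff _).2 h0, finrank_bot]
    exact zero_le_one

variable (F K) in
/-- The map `(x, y) ↦ (x, x ^ q, y, y ^ q)`. -/
noncomputable def frobeniusGraph : K × K →ₗ[F] (Fin 4 → K) where
  toFun z := ![z.1, z.1 ^ Nat.card F, z.2, z.2 ^ Nat.card F]
  map_add' z w := by
    ext i; fin_cases i <;> simp [add_pow_natCard F]
  map_smul' c z := by
    ext i; fin_cases i <;> simp [Algebra.smul_def, mul_pow, algebraMap_pow_natCard]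

variable (F K) in
lemma exists_isScatteredLinearSet [Finite K] :
    ∃ S : Set (ProjSub K 3 0), IsScatteredLinearSet F (2 * Module.finrank F K) S := by
  refine ⟨_, LinearMap.range (frobeniusGraph F K), ?_, ?_, rfl⟩
  · rw [LinearMap.finrank_range_of_inj, Module.finrank_prod, two_mul]
    intro z w h
    exact Prod.ext (congrFun h 0) (congrFun h 2)
  · apply isScattered_of_forall
    rintro _ ⟨z, rfl⟩ hz c ⟨w, hw⟩
    have h0 : w.1 = c * z.1 := congrFun hw 0
    have h1 : w.1 ^ Nat.card F = c * z.1 ^ Nat.card F := congrFun hw 1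
    have h2 : w.2 = c * z.2 := congrFun hw 2
    have h3 : w.2 ^ Nat.card F = c * z.2 ^ Nat.card F := congrFun hw 3
    have hq : Nat.card F ≠ 0 := Nat.card_pos.ne'
    rw [h0, mul_pow] at h1
    rw [h2, mul_pow] at h3
    -- A nonzero entry `x` of `z` gives `c ^ q x ^ q = c x ^ q`; the pair of coordinates used is one
    -- where the entry does not vanish.
    by_cases hz1 : z.1 = 0
    · have hz2 : z.2 ≠ 0 := by
        intro hz2
        apply hz
        rw [show z = 0 from Prod.ext hz1 hz2, map_zero]
      exact mul_right_cancel₀ (pow_ne_zero _ hz2) h3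
    · exact mul_right_cancel₀ (pow_ne_zero _ hz1) h1

end Frobenius

/-! ### Projected subgeometries are scattered, and projection vertices exist. -/

section Projection

/-- The map `(x₀, …, x₅) ↦ (x₀ ^ q, …, x₅ ^ q)`, `q = |F|`. -/
noncomputable def frobVec (F : Type*) {K : Type*} [Field K] (v : Fin 6 → K) : Fin 6 → K :=
  fun i => v i ^ Nat.card F

lemma frobVec_mem_conjugate (F : Type*) {K : Type*} [Field K] {W : Submodule K (Fin 6 → K)}
    {v : Fin 6 → K} (hv : v ∈ W) : frobVec F v ∈ conjugate F W :=
  Submodule.subset_span ⟨v, hv, rfl⟩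

lemma eq_zero_of_frobVec_eq_zero {F K : Type*} [Field K] {v : Fin 6 → K}
    (h : frobVec F v = 0) : v = 0 := by
  ext i
  exact eq_zero_of_pow_eq_zero (congrFun h i)

/-- The relation `(c β₁) β₀ - (c β₀) β₁ = 0` has coefficients `w 1`, `-w 0` in `F`, so independence
gives `w 1 = 0`, that is `c β₁ = 0`. -/
lemma eq_zero_of_algebraMap_eq_mul {F K : Type*} [Field F] [Field K] [Algebra F K]
    {β : Fin 3 → K} (hβ : LinearIndependent F β) {w : Fin 3 → F} {c : K}
    (h : ∀ i, algebraMap F K (w i) = c * β i) : c = 0 := by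
  have h1 := Fintype.linearIndependent_iff.1 hβ ![w 1, -w 0, 0] (by
    simp [Fin.sum_univ_three, Algebra.smul_def, h]
    ring) 0
  have h2 := h 1
  simp only [Matrix.cons_val_zero] at h1
  rw [h1, map_zero, eq_comm, mul_eq_zero] at h2
  exact h2.resolve_right (hβ.ne_zero 1)

variable {F K : Type*} [Field F] [Finite F] [Field K] [Algebra F K]

variable (F) in
lemma frobVec_smul_add_smul (u v : Fin 6 → K) (b c : K) :
    frobVec F (b • u + c • v) = b ^ Nat.card F • frobVec F u + c ^ Nat.card F • frobVec F v := by
  ext i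
  simp [frobVec, add_pow_natCard F, mul_pow]

lemma frobVec_embed (w : Fin 6 → F) : frobVec F (embed K w) = embed K w := by
  ext i
  exact algebraMap_pow_natCard (w i)

variable (F) in
lemma finrank_conjugate_le {W : Submodule K (Fin 6 → K)} (hW : Module.finrank K W ≤ 2) :
    Module.finrank K (conjugate F W) ≤ 2 := by
  obtain ⟨u, v, hu⟩ : ∃ u v, W ≤ Submodule.span K {u, v} := by
    by_cases h0 : W = ⊥
    · exact ⟨0, 0, by simp [h0]⟩
    obtain ⟨u, hu, hu0⟩ := Submodule.exists_mem_ne_zero_of_ne_bot h0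
    by_cases hv : ∃ v ∈ W, v ∉ Submodule.span K {u}
    · obtain ⟨v, hv, hvu⟩ := hv
      refine ⟨u, v, (Submodule.eq_of_le_of_finrank_le ?_ ?_).ge⟩
      · rw [Submodule.span_le]
        rintro _ (rfl | rfl) <;> assumption
      · rwa [finrank_span_pair_eq_two hu0 hvu]
    · push Not at hv
      exact ⟨u, 0, fun w hw => Submodule.span_mono (by simp) (hv w hw)⟩
  have h : conjugate F W ≤ Submodule.span K {frobVec F u, frobVec F v} := by
    refine Submodule.span_le.2 ?_
    rintro _ ⟨w, hw, rfl⟩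
    obtain ⟨b, c, rfl⟩ := Submodule.mem_span_pair.1 (hu hw)
    exact Submodule.mem_span_pair.2 ⟨_, _, (frobVec_smul_add_smul F u v b c).symm⟩
  classical
  rw [← Finset.coe_pair] at h
  exact (Submodule.finrank_mono h).trans ((finrank_span_finset_le_card _).trans Finset.card_le_two)

/-- Three subspaces of dimension at most two that span a six-dimensional space are independent. -/
lemma eq_zero_of_add_eq_zero {A B C : Submodule K (Fin 6 → K)} (hA : Module.finrank K A ≤ 2)
    (hB : Module.finrank K B ≤ 2) (hC : Module.finrank K C ≤ 2) (h : A ⊔ B ⊔ C = ⊤)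
    {x y z : Fin 6 → K} (hx : x ∈ A) (hy : y ∈ B) (hz : z ∈ C) (h0 : x + y + z = 0) :
    z = 0 := by
  have h1 := Submodule.finrank_sup_add_finrank_inf_eq A B
  have h2 := Submodule.finrank_sup_add_finrank_inf_eq (A ⊔ B) C
  rw [h, finrank_top, Module.finrank_fin_fun] at h2
  have h3 : (A ⊔ B) ⊓ C = ⊥ := Submodule.finrank_eq_zero.1 (by omega)
  have h4 : z ∈ (A ⊔ B) ⊓ C := by
    refine ⟨?_, hz⟩
    rw [← neg_eq_of_add_eq_zero_right h0]
    exact neg_mem (Submodule.add_mem_sup hx hy)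
  rwa [h3, Submodule.mem_bot] at h4

/-- A projection vertex meets the line joining two points of `PG(5, F)` in no point with a
coordinate outside `F`. -/
lemma pow_eq_of_sub_smul_mem {l : ProjSub K 5 1} (hl : IsProjectionVertex F l)
    {w w₀ : Fin 6 → F} (hw₀ : w₀ ≠ 0) {c : K} (h : embed K w - c • embed K w₀ ∈ l.1) :
    c ^ Nat.card F = c := by
  by_contra hc
  have hz : ∀ d : K, frobVec F (embed K w - d • embed K w₀) =
      embed K w - d ^ Nat.card F • embed K w₀ := by
    intro d
    have := frobVec_smul_add_smul F (embed K w) (embed K w₀) 1 (-d)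
    have hneg : (-d) ^ Nat.card F = -(d ^ Nat.card F) := by
      rw [eq_neg_iff_add_eq_zero, ← add_pow_natCard F, neg_add_cancel,
        zero_pow Nat.card_pos.ne']
    rw [hneg, one_pow, one_smul, one_smul, frobVec_embed, frobVec_embed, neg_smul, neg_smul,
      ← sub_eq_add_neg, ← sub_eq_add_neg] at this
    exact this
  have h1 := frobVec_mem_conjugate F h
  have h2 := frobVec_mem_conjugate F h1
  rw [hz] at h1
  rw [hz, hz] at h2
  set c₁ := c ^ Nat.card F with hc₁
  set c₂ := c₁ ^ Nat.card F with hc₂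
  have hA : Module.finrank K l.1 ≤ 2 := l.2.le
  have hB := finrank_conjugate_le F hA
  -- The vectors `w - c w₀`, `w - c₁ w₀`, `w - c₂ w₀` lie in the span of `w` and `w₀`, and these
  -- differences of parameters are the coefficients of their linear relation. Independence of the
  -- three lines kills each term, and the last coefficient `c₁ - c` is nonzero.
  have h3 := eq_zero_of_add_eq_zero hA hB (finrank_conjugate_le F hB) hl.2
    (Submodule.smul_mem _ (c₂ - c₁) h) (Submodule.smul_mem _ (c - c₂) h1)
    (Submodule.smul_mem _ (c₁ - c) h2) (by
      ext i
      simp only [Pi.add_apply, Pi.smul_apply, Pi.sub_apply, smul_eq_mul, Pi.zero_apply]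
      ring)
  rw [smul_eq_zero, or_iff_right (sub_ne_zero.2 hc), ← hz, ← hz] at h3
  have h4 := eq_zero_of_frobVec_eq_zero (eq_zero_of_frobVec_eq_zero h3)
  have h5 := hz c
  rw [h4, eq_comm, ← h4] at h5
  have h6 : frobVec F (0 : Fin 6 → K) = 0 := by
    ext i
    exact zero_pow Nat.card_pos.ne'
  rw [h4, h6] at h5
  apply hw₀
  ext i
  have h7 := congrFun h4 i
  have h8 := congrFun h5 i
  simp only [Pi.smul_apply, Pi.sub_apply, smul_eq_mul, Pi.zero_apply] at h7 h8
  have h9 : (c₁ - c) * embed K w₀ i = 0 := by linear_combination h7 - h8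
  rw [mul_eq_zero, or_iff_right (sub_ne_zero.2 hc)] at h9
  exact (map_eq_zero (algebraMap F K)).1 h9

variable (F K) in
/-- The inclusion of `F ^ 6` in `K ^ 6`. -/
def embedLin : (Fin 6 → F) →ₗ[F] (Fin 6 → K) where
  toFun := embed K
  map_add' v w := by ext i; simp [embed]
  map_smul' c v := by ext i; simp [embed, Algebra.smul_def]

/-- The projection from `l` onto `α`, in the coordinates given by `φ`. -/
noncomputable def projLin {l α : Submodule K (Fin 6 → K)} (h : IsCompl α l)
    (φ : α ≃ₗ[K] (Fin 4 → K)) : (Fin 6 → K) →ₗ[K] (Fin 4 → K) :=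
  (φ : α →ₗ[K] (Fin 4 → K)) ∘ₗ Submodule.projectionOnto α l h

lemma projLin_eq_zero_iff {l α : Submodule K (Fin 6 → K)} (h : IsCompl α l)
    (φ : α ≃ₗ[K] (Fin 4 → K)) (x : Fin 6 → K) : projLin h φ x = 0 ↔ x ∈ l := by
  rw [projLin, LinearMap.comp_apply, LinearEquiv.coe_coe, LinearEquiv.map_eq_zero_iff,
    Submodule.projectionOnto_apply_eq_zero_iff]

lemma map_comap_sup_span_inf {l α : Submodule K (Fin 6 → K)} (h : IsCompl α l)
    (φ : α ≃ₗ[K] (Fin 4 → K)) (x : Fin 6 → K) :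
    (((l ⊔ Submodule.span K {x}) ⊓ α).comap α.subtype).map (φ : α →ₗ[K] (Fin 4 → K)) =
      Submodule.span K {projLin h φ x} := by
  ext p
  rw [Submodule.mem_span_singleton]
  constructor
  · rintro ⟨v, hv, rfl⟩
    obtain ⟨y, hy, z, hz, hyz⟩ := Submodule.mem_sup.1 hv.1
    obtain ⟨c, rfl⟩ := Submodule.mem_span_singleton.1 hz
    refine ⟨c, ?_⟩
    rw [← map_smul, LinearEquiv.coe_coe, ← Submodule.projectionOnto_apply_left h v]
    change projLin h φ (c • x) = projLin h φ v
    rw [← sub_eq_zero, ← map_sub, projLin_eq_zero_iff]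
    have : c • x - v = -y := by
      change y + c • x = v at hyz
      rw [← hyz]
      abel
    rw [this]
    exact neg_mem hy
  · rintro ⟨c, rfl⟩
    refine Submodule.smul_mem _ c ⟨Submodule.projectionOnto α l h x, ⟨?_, ?_⟩, rfl⟩
    · refine Submodule.mem_sup.2
        ⟨Submodule.projectionOnto α l h x - x, ?_, x, Submodule.mem_span_singleton_self x, by simp⟩
      rw [← Submodule.projectionOnto_apply_eq_zero_iff h, map_sub,
        Submodule.projectionOnto_apply_left, sub_self]
    · exact (Submodule.projectionOnto α l h x).2

/-- The defining subspace is the image of `F ^ 6` under the projection with kernel `l`. Skewness of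
`l` keeps the rank at 6; a relation `g w = c • g w₀` means `w - c w₀ ∈ l`, which forces `c` into
`F`. -/
lemma isScatteredLinearSet_projectedSubgeometry [Finite K] {l : ProjSub K 5 1}
    (hl : IsProjectionVertex F l) {α : ProjSub K 5 3} (hα : Disjoint l.1 α.1)
    (φ : α.1 ≃ₗ[K] (Fin 4 → K)) :
    IsScatteredLinearSet F 6 (projectedSubgeometry F l α φ) := by
  have h : IsCompl α.1 l.1 := by
    refine ⟨hα.symm, codisjoint_iff.2 (Submodule.eq_top_of_finrank_eq ?_)⟩
    have := Submodule.finrank_sup_add_finrank_inf_eq α.1 l.1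
    rw [hα.symm.eq_bot, finrank_bot, l.2, α.2] at this
    rw [Module.finrank_fin_fun]
    omega
  let g : (Fin 6 → F) →ₗ[F] (Fin 4 → K) := (projLin h φ).restrictScalars F ∘ₗ embedLin F K
  have hg : ∀ w, g w = projLin h φ (embed K w) := fun w => rfl
  have hg0 : ∀ w, g w = 0 → w = 0 := by
    intro w hw
    rw [hg, projLin_eq_zero_iff] at hw
    exact by_contra fun h0 => hl.1 w h0 hw
  refine ⟨LinearMap.range g, ?_, ?_, ?_⟩
  · rw [LinearMap.finrank_range_of_inj ((injective_iff_map_eq_zero g).2 hg0),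
      Module.finrank_fin_fun]
  · apply isScattered_of_forall
    rintro _ ⟨w₀, rfl⟩ h0 c ⟨w, hw⟩
    rw [hg, hg, ← map_smul, ← sub_eq_zero, ← map_sub, projLin_eq_zero_iff] at hw
    exact pow_eq_of_sub_smul_mem hl (fun h => h0 (by rw [h, map_zero])) hw
  · ext P
    unfold projectedSubgeometry linearSet
    simp only [map_comap_sup_span_inf h φ, ← hg]
    constructor
    · rintro ⟨w, hw, hP⟩
      exact ⟨g w, ⟨w, rfl⟩, fun h => hw (hg0 w h), hP⟩
    · rintro ⟨_, ⟨w, rfl⟩, hw, hP⟩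
      exact ⟨w, fun h => hw (by rw [h, map_zero]), hP⟩

/-- The conjugates of a basis of a cubic extension form an invertible matrix. -/
lemma eq_zero_of_sum_conjugates_eq_zero [Finite K] (h3 : Module.finrank F K = 3)
    (β : Module.Basis (Fin 3) F K) (c : Fin 3 → K)
    (hc : ∀ j : Fin 3, ∑ i, β i ^ Nat.card F ^ (j : ℕ) * c i = 0) : c = 0 := by
  have := Fintype.ofFinite F
  set σ := FiniteField.frobeniusAlgHom F K with hσ
  have hσp : ∀ (j : ℕ) (x : K), (σ ^ j) x = x ^ Nat.card F ^ j := by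
    intro j
    induction j with
    | zero => simp
    | succ j ih =>
      intro x
      rw [pow_succ', AlgHom.mul_apply, ih, hσ, FiniteField.frobeniusAlgHom_apply, ← pow_mul,
        pow_succ, Nat.card_eq_fintype_card]
  -- Dedekind's independence of characters, applied to the powers `1, σ, σ ^ 2`, which are distinct
  -- because Frobenius has order 3.
  have hli : LinearIndependent K fun j : Fin 3 => ((σ ^ (j : ℕ) : K →ₐ[F] K) : K → K) := by
    refine (linearIndependent_monoidHom K K).comp
      (fun j : Fin 3 => ((σ ^ (j : ℕ) : K →ₐ[F] K) : K →* K)) fun i j hij => ?_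
    have h1 : σ ^ (i : ℕ) = σ ^ (j : ℕ) := by
      ext x
      exact DFunLike.congr_fun hij x
    have ho : orderOf σ = 3 := (FiniteField.orderOf_frobeniusAlgHom F K).trans h3
    exact Fin.ext (pow_injOn_Iio_orderOf (by simp [ho]) (by simp [ho]) h1)
  by_contra hc0
  have hM : (Matrix.of fun j i : Fin 3 => β i ^ Nat.card F ^ (j : ℕ)).mulVec c = 0 := by
    ext j
    exact hc j
  obtain ⟨d, hd, hdM⟩ := Matrix.exists_vecMul_eq_zero_iff.2
    (Matrix.exists_mulVec_eq_zero_iff.1 ⟨c, hc0, hM⟩)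
  apply hd
  ext j
  refine Fintype.linearIndependent_iff.1 hli d ?_ j
  -- A relation between the rows of the matrix is a combination of the `σ ^ j` that vanishes on the
  -- basis `β`, hence on all of `K`.
  have hlin : ∑ j : Fin 3, d j • (σ ^ (j : ℕ) : K →ₐ[F] K).toLinearMap = 0 := by
    refine β.ext fun i => ?_
    have := congrFun hdM i
    simpa [Matrix.vecMul, dotProduct, hσp, -AlgHom.coe_pow] using this
  ext x
  simpa using LinearMap.congr_fun hlin x

lemma exists_isProjectionVertex [Finite K] (h3 : Module.finrank F K = 3) :
    ∃ l : ProjSub K 5 1, IsProjectionVertex F l := by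
  let β := Module.finBasisOfFinrankEq F K h3
  have hβ := β.linearIndependent
  have hβ0 := hβ.ne_zero
  -- Each block repeats a basis of `K` over `F`: its conjugates span the three coordinates of the
  -- block.
  let u : Fin 6 → K := ![β 0, β 1, β 2, 0, 0, 0]
  let v : Fin 6 → K := ![0, 0, 0, β 0, β 1, β 2]
  have hu0 : u ≠ 0 := fun h => hβ0 0 (congrFun h 0)
  have hvu : v ∉ Submodule.span K {u} := by
    intro h
    obtain ⟨c, hc⟩ := Submodule.mem_span_singleton.1 h
    have := congrFun hc 3
    simp [u, v] at this
    exact hβ0 0 this.symm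
  refine ⟨⟨Submodule.span K {u, v}, finrank_span_pair_eq_two hu0 hvu⟩, ?_, ?_⟩
  · intro w hw h
    obtain ⟨b, c, hbc⟩ := Submodule.mem_span_pair.1 h
    have hb : b = 0 := by
      refine eq_zero_of_algebraMap_eq_mul hβ (w := ![w 0, w 1, w 2]) fun i => ?_
      fin_cases i
      · simpa [embed, u, v] using (congrFun hbc 0).symm
      · simpa [embed, u, v] using (congrFun hbc 1).symm
      · simpa [embed, u, v] using (congrFun hbc 2).symm
    have hc : c = 0 := by
      refine eq_zero_of_algebraMap_eq_mul hβ (w := ![w 3, w 4, w 5]) fun i => ?_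
      fin_cases i
      · simpa [embed, u, v] using (congrFun hbc 3).symm
      · simpa [embed, u, v] using (congrFun hbc 4).symm
      · simpa [embed, u, v] using (congrFun hbc 5).symm
    rw [hb, hc, zero_smul, zero_smul, add_zero] at hbc
    apply hw
    ext i
    exact (map_eq_zero (algebraMap F K)).1 (congrFun hbc i).symm
  -- Otherwise a nonzero functional `a` kills `l` and its conjugates. Evaluating it on the
  -- conjugates of `u` and `v` gives two linear systems with the invertible matrix of conjugates of
  -- `β`, so `a = 0`.
  · by_contra hne
    obtain ⟨p, -, hp⟩ := SetLike.exists_of_lt (lt_top_iff_ne_top.2 hne)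
    obtain ⟨a, hpa, ha⟩ := exists_dotProduct_of_notMem hp
    have key : ∀ x ∈ Submodule.span K {u, v}, ∀ j : Fin 3,
        (fun i => x i ^ Nat.card F ^ (j : ℕ)) ⬝ᵥ a = 0 := by
      intro x hx j
      have h1 := frobVec_mem_conjugate F hx
      have h2 := frobVec_mem_conjugate F h1
      apply ha
      fin_cases j
      · simpa using Submodule.mem_sup_left (Submodule.mem_sup_left hx)
      · refine Submodule.mem_sup_left (Submodule.mem_sup_right ?_)
        convert h1 using 1
        ext i
        simp [frobVec]
      · refine Submodule.mem_sup_right ?_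
        convert h2 using 1
        ext i
        simp [frobVec, ← pow_mul, sq]
    have hq : Nat.card F ≠ 0 := Nat.card_pos.ne'
    have h1 : ![a 0, a 1, a 2] = 0 := by
      refine eq_zero_of_sum_conjugates_eq_zero h3 β _ fun j => ?_
      simpa [u, dotProduct, Fin.sum_univ_succ, hq] using
        key u (Submodule.subset_span (by simp)) j
    have h2 : ![a 3, a 4, a 5] = 0 := by
      refine eq_zero_of_sum_conjugates_eq_zero h3 β _ fun j => ?_
      simpa [v, dotProduct, Fin.sum_univ_succ, hq] using
        key v (Submodule.subset_span (by simp)) j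
    have ha0 : a = 0 := by
      ext i
      fin_cases i
      exacts [congrFun h1 0, congrFun h1 1, congrFun h1 2, congrFun h2 0, congrFun h2 1,
        congrFun h2 2]
    rw [ha0, dotProduct_zero] at hpa
    exact zero_ne_one hpa

end Projection
end KleinCL

theorem mainTheorem2 (q t : ℕ) (ht : 2 ≤ t)
    (F K : Type*) [Field F] [Finite F] [Field K] [Finite K] [Algebra F K]
    (hF : Nat.card F = q) (hK : Module.finrank F K = t) :
    -- scattered linear sets of rank `2t` exist in `PG(3, q ^ t)`
    (∃ S : Set (KleinCL.ProjSub K 3 0), KleinCL.IsScatteredLinearSet F (2 * t) S) ∧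
    -- each of them gives a Cameron-Liebler set with parameter `(q ^ t - 1) / (q - 1)`
    (∀ S : Set (KleinCL.ProjSub K 3 0), KleinCL.IsScatteredLinearSet F (2 * t) S →
      KleinCL.IsDegreeOneCameronLiebler
        (KleinCL.kleinSet S (KleinCL.planesMeetingIn S (KleinCL.theta t q)))
        (((q : ℝ) ^ t - 1) / ((q : ℝ) - 1)) ∧
      KleinCL.IsCameronLiebler
        (KleinCL.kleinSet S (KleinCL.planesMeetingIn S (KleinCL.theta t q)))
        (((q : ℝ) ^ t - 1) / ((q : ℝ) - 1))) ∧
    -- the case `t = 3` contains the projected subgeometries `PG(5, q)`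
    (t = 3 →
      (∃ l : KleinCL.ProjSub K 5 1, KleinCL.IsProjectionVertex F l) ∧
      ∀ l : KleinCL.ProjSub K 5 1, KleinCL.IsProjectionVertex F l →
      ∀ α : KleinCL.ProjSub K 5 3, Disjoint l.1 α.1 →
      ∀ φ : α.1 ≃ₗ[K] (Fin 4 → K),
        KleinCL.IsScatteredLinearSet F 6 (KleinCL.projectedSubgeometry F l α φ) ∧
        KleinCL.IsDegreeOneCameronLiebler
          (KleinCL.kleinSet (KleinCL.projectedSubgeometry F l α φ)
            (KleinCL.planesMeetingIn (KleinCL.projectedSubgeometry F l α φ)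
              (KleinCL.theta 3 q)))
          ((q : ℝ) ^ 2 + q + 1) ∧
        KleinCL.IsCameronLiebler
          (KleinCL.kleinSet (KleinCL.projectedSubgeometry F l α φ)
            (KleinCL.planesMeetingIn (KleinCL.projectedSubgeometry F l α φ)
              (KleinCL.theta 3 q)))
          ((q : ℝ) ^ 2 + q + 1)) := by
  have := Fintype.ofFinite K
  have hq := KleinCL.one_lt_natCard (F := F)
  rw [hF] at hq
  have hQ : (Nat.card K : ℝ) = (q : ℝ) ^ t := by
    rw [KleinCL.natCard_eq_pow (F := F), hF, hK, Nat.cast_pow]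
  have main : ∀ S : Set (KleinCL.ProjSub K 3 0), KleinCL.IsScatteredLinearSet F (2 * t) S →
      KleinCL.IsDegreeOneCameronLiebler
        (KleinCL.kleinSet S (KleinCL.planesMeetingIn S (KleinCL.theta t q)))
        (((q : ℝ) ^ t - 1) / ((q : ℝ) - 1)) ∧
      KleinCL.IsCameronLiebler
        (KleinCL.kleinSet S (KleinCL.planesMeetingIn S (KleinCL.theta t q)))
        (((q : ℝ) ^ t - 1) / ((q : ℝ) - 1)) := by
    rintro _ ⟨U, hU, hs, rfl⟩
    rw [← hK] at hU
    have h1 := KleinCL.isDegreeOneCameronLiebler_clSet hU hs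
    have h2 := KleinCL.isCameronLiebler_clSet hU hs
    rw [KleinCL.clSet, hK, hF, hQ] at h1 h2
    exact ⟨h1, h2⟩
  refine ⟨hK ▸ KleinCL.exists_isScatteredLinearSet F K, main, ?_⟩
  rintro rfl
  refine ⟨KleinCL.exists_isProjectionVertex hK, fun l hl α hα φ => ?_⟩
  have h := KleinCL.isScatteredLinearSet_projectedSubgeometry hl hα φ
  have hx : ((q : ℝ) ^ 3 - 1) / ((q : ℝ) - 1) = (q : ℝ) ^ 2 + q + 1 := by
    rw [div_eq_iff (by linarith)]
    ring
  exact ⟨h, hx ▸ main _ h⟩
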